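/- There are $n$ items, of which an unknown subset $\mathcal K$ of known size $k=k(n)$ is defective. In nonadaptive noiseless group testing with a Bernoulli design with $T$ tests, each item is placed in each test independently with the same probability $p\in[0,1]$ ($p$ may depend on $n$); a test is positive if it contains at least one defective item, and negative otherwise. A detection algorithm is a map that, given the whole test design and the $T$ outcomes, returns an estimate of $\mathcal K$. Its error probability is the probability, over the random design, that the estimate differs from $\mathcal K$, averaged over all $\binom nk$ sets $\mathcal K$ of size $k$. Write $h(x)=x\log_2\frac1x+(1-x)\log_2\frac1{1-x}$ for the binary entropy. (1) Let $k=o(n)$ as $n\to\infty$, and let $$T^*=T^*(n)=\min_{\nu>0}\max\left\{\frac{1}{\nu e^{-\nu}}\,k\ln k,\ \frac{1}{h(e^{-\nu})}\log_2\binom nk\right\}$$ (the minimum is attained; $0\ln 0=0$). Let $\delta>0$. If $T=T(n)>(1+\delta)T^*(n)$ for all large $n$, then there are Bernoulli designs with $T(n)$ tests (that is, a choice of $p=p(n)$) and detection algorithms whose error probability tends to $0$ as $n\to\infty$. On the other hand, for all large enough $n$ (depending on $\delta$ and on the sequence $k$ only), with any number $T<(1-\delta)T^*(n)$ of tests, every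 Bernoulli design and every detection algorithm have error probability at least $1/2$. (2) Let $\theta\in[0,1)$ and $k=\Theta(n^\theta)$. Call a rate $R>0$ achievable if there are Bernoulli designs with $T(n)\le\log_2\binom nk/R$ tests for all large $n$ and detection algorithms whose error probability tends to $0$ as $n\to\infty$; the capacity is the supremum of the achievable rates. Then the capacity is $$C(\theta)=\max_{\nu>0}\min\left\{\frac{\nu e^{-\nu}}{\ln 2}\,\frac{1-\theta}{\theta},\ h(e^{-\nu})\right\},$$ where the maximum is attained and, for $\theta=0$, the first term is read as $+\infty$. -/

import Mathlib

open Filter Asymptotics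

namespace GroupTesting

/-- A test design for `n` items and `T` tests: `X i t = true` means that item `i` is in test `t`. -/
abbrev TestDesign (n T : ℕ) : Type := Fin n → Fin T → Bool

/-- The noiseless outcomes: a test is positive iff it contains an item of the defective set `K`. -/
def outcome {n T : ℕ} (X : TestDesign n T) (K : Finset (Fin n)) : Fin T → Bool :=
  fun t => decide (∃ i ∈ K, X i t = true)

/-- A detection algorithm estimates the defective set from the test design and the outcomes. -/
abbrev DetectionAlgorithm (n T : ℕ) : Type :=
  TestDesign n T → (Fin T → Bool) → Finset (Fin n)

/-- The probability of the design `X` when each item is in each test independently with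
probability `p`. -/
noncomputable def designProb {n T : ℕ} (p : ℝ) (X : TestDesign n T) : ℝ :=
  ∏ i, ∏ t, if X i t = true then p else 1 - p

/-- The probability, over the Bernoulli(`p`) design, that the algorithm `D` does not return the
defective set, when the defective set is `K`. -/
noncomputable def errorProbGiven {n T : ℕ} (p : ℝ) (D : DetectionAlgorithm n T)
    (K : Finset (Fin n)) : ℝ :=
  ∑ X : TestDesign n T with D X (outcome X K) ≠ K, designProb p X

/-- The average error probability over all defective sets of size `k`. -/
noncomputable def errorProb {n T : ℕ} (k : ℕ) (p : ℝ) (D : DetectionAlgorithm n T) : ℝ :=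
  (1 / (n.choose k : ℝ)) *
    ∑ K ∈ Finset.powersetCard k (Finset.univ : Finset (Fin n)), errorProbGiven p D K

/-- The binary entropy, in bits. -/
noncomputable def binaryEntropy (x : ℝ) : ℝ :=
  x * Real.logb 2 (1 / x) + (1 - x) * Real.logb 2 (1 / (1 - x))

/-- `log₂ (n choose k)`, the number of bits needed to specify the defective set. -/
noncomputable def logChoose (n k : ℕ) : ℝ := Real.logb 2 (n.choose k : ℝ)

/-- The maximum of the two bounds on the number of tests at the parameter `ν`. -/
noncomputable def testsAt (n k : ℕ) (ν : ℝ) : ℝ :=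
  max (1 / (ν * Real.exp (-ν)) * ((k : ℝ) * Real.log k))
    (1 / binaryEntropy (Real.exp (-ν)) * logChoose n k)

/-- The threshold `T*`, the infimum of `testsAt n k ν` over `ν > 0`. -/
noncomputable def Tstar (n k : ℕ) : ℝ := sInf (testsAt n k '' Set.Ioi 0)

/-- The minimum of the two bounds on the rate at the parameter `ν`. For `θ = 0` the first bound
is `+∞`, so that the minimum is the second one. -/
noncomputable def rateAt (θ ν : ℝ) : ℝ :=
  if θ = 0 then binaryEntropy (Real.exp (-ν))
  else min (ν * Real.exp (-ν) / Real.log 2 * ((1 - θ) / θ)) (binaryEntropy (Real.exp (-ν)))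

/-- The supremum of `rateAt θ ν` over `ν > 0`. -/
noncomputable def capacityFormula (θ : ℝ) : ℝ := sSup (rateAt θ '' Set.Ioi 0)

/-- The rate `R > 0` is achievable by Bernoulli nonadaptive testing with `k n` defectives among
`n` items: some Bernoulli designs with at most `log₂ (n choose k) / R` tests and some detection
algorithms have error probability tending to `0`. -/
def Achievable (k : ℕ → ℕ) (R : ℝ) : Prop :=
  0 < R ∧ ∃ (T : ℕ → ℕ) (p : ℕ → ℝ) (D : ∀ n, DetectionAlgorithm n (T n)),
    (∀ n, p n ∈ Set.Icc (0 : ℝ) 1) ∧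
    (∀ᶠ n in atTop, (T n : ℝ) ≤ logChoose n (k n) / R) ∧
    Tendsto (fun n => errorProb (k n) (p n) (D n)) atTop (nhds 0)

end GroupTesting

/-!
The proof bounds the error of the best detection algorithm from both sides in terms of the
probability `exp (-ν) = (1 - p) ^ k` that a test is negative.

*Achievability.* The algorithm returns some set of size `k` that is consistent with the outcomes. It
errs only if some `l` of the `k` defective items can be exchanged for `l` nondefective ones. Given
the rows of the defective items, the probability that such an exchange exists is at most `1` and at
most a union bound, hence at most the `ρ`-th power of the union bound for each `ρ ∈ [0, 1]`, and the
tests are independent (`errorProb_consistentDecoder_le`). For `l` below a fixed fraction of `k`, a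
fixed small `ρ` works: a test contains one of the `l` items and no other defective item with
probability about `l ν exp (-ν) / k`, so that the bound `k log k / (ν exp (-ν))` on the number of
tests, aided by the other bound when `k` grows slowly, beats the at most `k ^ l` choices of the
exchanged defective items (`codingTerm_le_of_small`). For larger `l`, as `ρ → 0` the exponent
becomes the information in the outcomes about the `l` items; concavity of
`u ↦ exp u * binEntropy (exp (-u))` shows that this is at least the fraction `l / k` of the
information about all `k` items (`mul_binEntropy_le`), and since `k = o(n)` the at most `2 ^ k`
choices of the exchanged defective items do not matter (`codingTerm_le_of_large`).

*Converse.* Below the bound `log (n choose k) / binEntropy (exp (-ν))` the typical outcome vectors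
are too few: the number of sets detected through an outcome vector `y` is at most `1` and at most
the number of sets with outcomes `y`, which leads to a bound by a Rényi entropy of an order that
tends to `1` (`one_sub_errorProb_le_rpow`, `eventually_half_le_errorProb_of_entropy`). Below the bound
`k log k / (ν exp (-ν))` a second-moment argument shows that some defective item is masked, that is,
each test that contains it contains another defective item, and that at least two nondefective items
are in no negative test. The masked item may be exchanged for either of them, so at least three sets
are equally plausible (`one_sub_errorProb_le_of_confusable`,
`eventually_half_le_errorProb_of_masked`).

Both bounds improve when `ν` is moved into `[log 2, 1]` (`exists_mem_Icc_le`), so that the minimum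
defining the threshold and the maximum defining the capacity are attained there. For `k = Θ(n ^ θ)`
the ratio `k log k / log (n choose k)` tends to `θ / (1 - θ)`, so `Tstar` is asymptotic to
`logChoose n k / capacityFormula θ` (`tendsto_Tstar_div_logChoose`), which gives the capacity.
-/

namespace GroupTesting

section Design

open Finset

variable {n T : ℕ}

/-! ### Finite probability over Bernoulli designs -/

/-- The expectation of `F` over the Bernoulli(`p`) design. Probabilities of events are expectations
of `0`-`1` valued functions. -/
noncomputable def expect (p : ℝ) (F : TestDesign n T → ℝ) : ℝ := ∑ X, designProb p X * F X

/-- The expectation of `f` over a single test, in which each item is placed independently with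
probability `p`. -/
noncomputable def testExpect (p : ℝ) (f : (Fin n → Bool) → ℝ) : ℝ :=
  ∑ c : Fin n → Bool, (∏ i, if c i = true then p else 1 - p) * f c

/-- The indicator that the test `c` contains no item of `S`. -/
noncomputable def absent (S : Finset (Fin n)) (c : Fin n → Bool) : ℝ :=
  if ∀ i ∈ S, c i = false then 1 else 0

theorem designProb_nonneg {p : ℝ} (hp : p ∈ Set.Icc (0 : ℝ) 1) (X : TestDesign n T) :
    0 ≤ designProb p X := by
  refine prod_nonneg fun i _ => prod_nonneg fun t _ => ?_
  split_ifs
  · exact hp.1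
  · linarith [hp.2]

theorem testExpect_prod (p : ℝ) (f : Fin n → Bool → ℝ) :
    testExpect p (fun c => ∏ i, f i (c i)) = ∏ i, (p * f i true + (1 - p) * f i false) := by
  have h : ∀ i, p * f i true + (1 - p) * f i false
      = ∑ b : Bool, (if b = true then p else 1 - p) * f i b := by
    intro i; simp
  simp_rw [h, testExpect, ← prod_mul_distrib]
  rw [prod_univ_sum, Fintype.piFinset_univ]

theorem testExpect_const (p x : ℝ) : testExpect p (fun _ : Fin n → Bool => x) = x := by
  have h := testExpect_prod (n := n) p (fun _ _ => 1)
  simp only [prod_const_one, mul_one, add_sub_cancel] at h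
  simp only [testExpect, ← sum_mul, mul_one] at h ⊢
  rw [h, one_mul]

theorem testExpect_absent (p : ℝ) (S : Finset (Fin n)) :
    testExpect p (absent S) = (1 - p) ^ S.card := by
  have h := testExpect_prod (n := n) p (fun i b => if i ∈ S ∧ b = true then 0 else 1)
  have h1 : absent S = fun c : Fin n → Bool => ∏ i, if i ∈ S ∧ c i = true then (0 : ℝ) else 1 := by
    funext c
    unfold absent
    split_ifs with hc
    · rw [prod_eq_one]
      intro i _
      rw [if_neg]
      rintro ⟨h1, h2⟩
      simp [hc i h1] at h2
    · push Not at hc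
      obtain ⟨i, hi, hc⟩ := hc
      rw [prod_eq_zero (mem_univ i)]
      simp [hi, hc]
  rw [h1, h]
  have h2 : ∀ i, p * (if i ∈ S ∧ true = true then (0 : ℝ) else 1)
      + (1 - p) * (if i ∈ S ∧ false = true then (0 : ℝ) else 1) = if i ∈ S then 1 - p else 1 := by
    intro i
    by_cases hi : i ∈ S <;> simp [hi]
  rw [prod_congr rfl fun i _ => h2 i, prod_ite_mem, univ_inter, prod_const]

theorem testExpect_add (p : ℝ) (f g : (Fin n → Bool) → ℝ) :
    testExpect p (fun c => f c + g c) = testExpect p f + testExpect p g := by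
  simp only [testExpect, mul_add, sum_add_distrib]

theorem testExpect_sub (p : ℝ) (f g : (Fin n → Bool) → ℝ) :
    testExpect p (fun c => f c - g c) = testExpect p f - testExpect p g := by
  simp only [testExpect, mul_sub, sum_sub_distrib]

theorem testExpect_mul_const (p x : ℝ) (f : (Fin n → Bool) → ℝ) :
    testExpect p (fun c => f c * x) = testExpect p f * x := by
  simp only [testExpect, ← mul_assoc, sum_mul]

/-- The tests of a Bernoulli design are independent. -/
theorem expect_prod (p : ℝ) (g : Fin T → (Fin n → Bool) → ℝ) :
    expect p (fun X : TestDesign n T => ∏ t, g t (fun i => X i t)) = ∏ t, testExpect p (g t) := by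
  unfold testExpect expect designProb
  rw [prod_univ_sum, Fintype.piFinset_univ]
  refine Fintype.sum_equiv (Equiv.piComm fun _ _ => Bool) _ _ fun X => ?_
  beta_reduce
  rw [Finset.prod_comm, ← prod_mul_distrib]
  rfl

theorem sum_designProb (p : ℝ) : ∑ X : TestDesign n T, designProb p X = 1 := by
  have h := expect_prod (n := n) (T := T) p (fun _ _ => 1)
  simpa [expect, testExpect_const] using h

theorem expect_const (p x : ℝ) : expect p (fun _ : TestDesign n T => x) = x := by
  simp only [expect, ← sum_mul, sum_designProb, one_mul]

theorem expect_mono {p : ℝ} (hp : p ∈ Set.Icc (0 : ℝ) 1) {F G : TestDesign n T → ℝ}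
    (h : ∀ X, F X ≤ G X) : expect p F ≤ expect p G :=
  sum_le_sum fun X _ => mul_le_mul_of_nonneg_left (h X) (designProb_nonneg hp X)

theorem expect_sum {ι : Type*} (p : ℝ) (s : Finset ι) (F : ι → TestDesign n T → ℝ) :
    expect p (fun X => ∑ i ∈ s, F i X) = ∑ i ∈ s, expect p (F i) := by
  simp only [expect, mul_sum]
  rw [sum_comm]

theorem expect_add (p : ℝ) (F G : TestDesign n T → ℝ) :
    expect p (fun X => F X + G X) = expect p F + expect p G := by
  simp only [expect, mul_add, sum_add_distrib]

theorem expect_sub (p : ℝ) (F G : TestDesign n T → ℝ) :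
    expect p (fun X => F X - G X) = expect p F - expect p G := by
  simp only [expect, mul_sub, sum_sub_distrib]

theorem expect_const_mul (p x : ℝ) (F : TestDesign n T → ℝ) :
    expect p (fun X => x * F X) = x * expect p F := by
  simp only [expect, mul_sum, mul_left_comm]

/-- The rows of a Bernoulli design are independent: the rows of the items in `S` may be resampled
separately from the other rows. The exchange of the rows outside `S` between two independent
designs preserves their joint law. -/
theorem expect_splice (p : ℝ) (S : Finset (Fin n)) (F : TestDesign n T → ℝ) :
    expect p F = expect p fun Z : TestDesign n T => expect p fun Z' : TestDesign n T =>
      F fun i => if i ∈ S then Z i else Z' i := by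
  let spl : TestDesign n T → TestDesign n T → TestDesign n T :=
    fun Z Z' i => if i ∈ S then Z i else Z' i
  have hw : ∀ Z Z', designProb p (spl Z Z') * designProb p (spl Z' Z)
      = designProb p Z * designProb p Z' := by
    intro Z Z'
    unfold designProb
    rw [← prod_mul_distrib, ← prod_mul_distrib]
    refine prod_congr rfl fun i _ => ?_
    by_cases hi : i ∈ S
    · simp [spl, hi]
    · simp only [spl, hi, if_false]
      rw [mul_comm]
  have hinv : ∀ Z Z', spl (spl Z Z') (spl Z' Z) = Z := by
    intro Z Z'
    funext i
    by_cases hi : i ∈ S <;> simp [spl, hi]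
  let e : TestDesign n T × TestDesign n T ≃ TestDesign n T × TestDesign n T :=
    { toFun := fun z => (spl z.1 z.2, spl z.2 z.1)
      invFun := fun z => (spl z.1 z.2, spl z.2 z.1)
      left_inv := fun z => by simp only [hinv]
      right_inv := fun z => by simp only [hinv] }
  have h1 : (expect p fun Z : TestDesign n T => expect p fun Z' : TestDesign n T => F (spl Z Z'))
      = ∑ z : TestDesign n T × TestDesign n T,
          designProb p z.1 * designProb p z.2 * F (spl z.1 z.2) := by
    rw [Fintype.sum_prod_type]
    simp only [expect, mul_sum, mul_assoc]
  have h2 : ∑ z : TestDesign n T × TestDesign n T, designProb p z.1 * designProb p z.2 * F z.1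
      = expect p F := by
    rw [Fintype.sum_prod_type]
    simp only [expect]
    refine sum_congr rfl fun Z _ => ?_
    rw [← sum_mul, ← mul_sum, sum_designProb, mul_one]
  change _ = (expect p fun Z : TestDesign n T => expect p fun Z' : TestDesign n T => F (spl Z Z'))
  rw [h1, ← h2]
  symm
  refine Fintype.sum_equiv e _ _ fun z => ?_
  simp only [e, Equiv.coe_fn_mk, hw]

theorem absent_mul_absent (S S' : Finset (Fin n)) (c : Fin n → Bool) :
    absent S c * absent S' c = absent (S ∪ S') c := by
  unfold absent
  simp only [mem_union, or_imp, forall_and]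
  split_ifs <;> simp_all

theorem absent_eq_zero_or_one (S : Finset (Fin n)) (c : Fin n → Bool) :
    absent S c = 0 ∨ absent S c = 1 := by
  unfold absent
  split_ifs <;> simp

theorem absent_eq_one_iff {S : Finset (Fin n)} {c : Fin n → Bool} :
    absent S c = 1 ↔ ∀ i ∈ S, c i = false := by
  unfold absent
  split_ifs with h
  · simp only [true_iff]; exact h
  · simp only [zero_ne_one, false_iff]; exact h

theorem absent_anti {S S' : Finset (Fin n)} (h : S ⊆ S') (c : Fin n → Bool) :
    absent S' c ≤ absent S c := by
  unfold absent
  split_ifs with h1 h2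
  · exact le_rfl
  · exact absurd (fun i hi => h1 i (h hi)) h2
  · exact zero_le_one
  · exact le_rfl

theorem outcome_eq_false_iff (X : TestDesign n T) (K : Finset (Fin n)) (t : Fin T) :
    outcome X K t = false ↔ ∀ i ∈ K, X i t = false := by
  simp [outcome]

theorem errorProbGiven_eq (p : ℝ) (D : DetectionAlgorithm n T) (K : Finset (Fin n)) :
    errorProbGiven p D K = expect p fun X => if D X (outcome X K) ≠ K then 1 else 0 := by
  simp only [errorProbGiven, expect, mul_ite, mul_one, mul_zero, sum_filter]

/-! ### Converse bounds for a fixed number of tests -/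

/-- The average success probability is the average of the probabilities of correct detection. -/
theorem one_sub_errorProb {k : ℕ} (hk : k ≤ n) (p : ℝ) (D : DetectionAlgorithm n T) :
    1 - errorProb k p D = (1 / (n.choose k : ℝ)) * ∑ K ∈ powersetCard k (univ : Finset (Fin n)),
      expect p fun X => if D X (outcome X K) = K then 1 else 0 := by
  have hC : (n.choose k : ℝ) ≠ 0 := by
    exact_mod_cast (Nat.choose_pos hk).ne'
  have h : ∀ K : Finset (Fin n), (expect p fun X => if D X (outcome X K) = K then 1 else 0)
      = 1 - errorProbGiven p D K := by
    intro K
    rw [errorProbGiven_eq, ← expect_const (n := n) (T := T) p 1, ← expect_sub]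
    congr 1
    funext X
    by_cases hX : D X (outcome X K) = K <;> simp [hX, expect_const]
  simp only [h, sum_sub_distrib, sum_const, card_powersetCard, card_univ, Fintype.card_fin,
    nsmul_eq_mul, mul_one, errorProb, mul_sub]
  rw [one_div_mul_cancel hC]

/-- The law of the outcomes: the tests are independently negative with probability
`(1 - p) ^ k`. -/
theorem expect_outcome_eq (p : ℝ) (K : Finset (Fin n)) (y : Fin T → Bool) :
    (expect p fun X => if outcome X K = y then 1 else 0)
      = ∏ t, if y t = true then 1 - (1 - p) ^ K.card else (1 - p) ^ K.card := by
  have h := expect_prod (T := T) p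
    (fun t (c : Fin n → Bool) => if y t = true then 1 - absent K c else absent K c)
  have h2 : ∀ t, testExpect p
      (fun c : Fin n → Bool => if y t = true then 1 - absent K c else absent K c)
      = if y t = true then 1 - (1 - p) ^ K.card else (1 - p) ^ K.card := by
    intro t
    split_ifs
    · rw [testExpect_sub, testExpect_const, testExpect_absent]
    · rw [testExpect_absent]
  simp only [h2] at h
  rw [← h]
  congr 1
  funext X
  split_ifs with hX
  · symm
    refine prod_eq_one fun t _ => ?_
    have ht : outcome X K t = y t := by rw [hX]
    split_ifs with hy
    · rcases absent_eq_zero_or_one K (fun i => X i t) with h0 | h1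
      · rw [h0, sub_zero]
      · rw [absent_eq_one_iff, ← outcome_eq_false_iff] at h1
        simp [h1, hy] at ht
    · rw [absent_eq_one_iff, ← outcome_eq_false_iff, ht]
      simpa using hy
  · obtain ⟨t, ht⟩ := Function.ne_iff.1 hX
    symm
    refine prod_eq_zero (mem_univ t) ?_
    split_ifs with hy
    · rw [sub_eq_zero, eq_comm, absent_eq_one_iff, ← outcome_eq_false_iff]
      rw [hy] at ht
      simpa using ht
    · rcases absent_eq_zero_or_one K (fun i => X i t) with h0 | h1
      · exact h0
      · rw [absent_eq_one_iff, ← outcome_eq_false_iff] at h1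
        simp [h1] at ht
        exact absurd ht hy

/-- The entropic converse, in Rényi form: for each outcome vector `y`, the number of defective sets
detected through `y` is at most `1` and at most the number of sets with outcome `y`, hence at most
the `s`-th power of the latter. -/
theorem one_sub_errorProb_le_rpow {k : ℕ} (hk : k ≤ n) {p : ℝ} (hp : p ∈ Set.Icc (0 : ℝ) 1)
    (D : DetectionAlgorithm n T) {s : ℝ} (hs0 : 0 < s) (hs1 : s ≤ 1) :
    1 - errorProb k p D ≤ (n.choose k : ℝ) ^ (s - 1) *
      (((1 - p) ^ k) ^ s + (1 - (1 - p) ^ k) ^ s) ^ T := by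
  set a := (1 - p) ^ k with ha
  have ha0 : 0 ≤ a := pow_nonneg (by linarith [hp.2]) _
  have ha1 : a ≤ 1 := pow_le_one₀ (by linarith [hp.2]) (by linarith [hp.1])
  set C : ℝ := (n.choose k : ℝ) with hCdef
  have hC : 0 < C := by
    rw [hCdef]; exact_mod_cast Nat.choose_pos hk
  let Q : (Fin T → Bool) → ℝ := fun y => ∏ t, if y t = true then 1 - a else a
  have hQ0 : ∀ y, 0 ≤ Q y := fun y => prod_nonneg fun t _ => by
    split_ifs
    · linarith
    · exact ha0
  rw [one_sub_errorProb hk]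
  have h1 : ∑ K ∈ powersetCard k (univ : Finset (Fin n)),
      (expect p fun X => if D X (outcome X K) = K then 1 else 0)
      = ∑ y : Fin T → Bool, expect p fun X => ∑ K ∈ powersetCard k (univ : Finset (Fin n)),
          if outcome X K = y ∧ D X y = K then 1 else 0 := by
    rw [← expect_sum, ← expect_sum]
    congr 1
    funext X
    rw [sum_comm]
    refine sum_congr rfl fun K _ => ?_
    rw [Fintype.sum_eq_single (outcome X K)]
    · simp
    · intro y hy
      rw [if_neg]
      exact fun h => hy h.1.symm
  have h2 : ∀ y : Fin T → Bool,
      (expect p fun X => ∑ K ∈ powersetCard k (univ : Finset (Fin n)),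
          if outcome X K = y ∧ D X y = K then (1 : ℝ) else 0) ≤ (C * Q y) ^ s := by
    intro y
    have hle1 : (expect p fun X => ∑ K ∈ powersetCard k (univ : Finset (Fin n)),
          if outcome X K = y ∧ D X y = K then (1 : ℝ) else 0) ≤ 1 := by
      refine le_of_le_of_eq (expect_mono (G := fun _ => 1) hp fun X => ?_) (expect_const p 1)
      calc _ ≤ ∑ K ∈ powersetCard k (univ : Finset (Fin n)), if D X y = K then (1 : ℝ) else 0 := by
            refine sum_le_sum fun K _ => ?_
            by_cases h1 : outcome X K = y <;> by_cases h2 : D X y = K <;> simp [h1, h2]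
        _ ≤ 1 := by
            rw [sum_ite_eq]
            split_ifs <;> norm_num
    have hle2 : (expect p fun X => ∑ K ∈ powersetCard k (univ : Finset (Fin n)),
          if outcome X K = y ∧ D X y = K then (1 : ℝ) else 0) ≤ C * Q y := by
      calc _ ≤ expect p fun X => ∑ K ∈ powersetCard k (univ : Finset (Fin n)),
            if outcome X K = y then (1 : ℝ) else 0 := by
            refine expect_mono hp fun X => sum_le_sum fun K _ => ?_
            by_cases h1 : outcome X K = y <;> by_cases h2 : D X y = K <;> simp [h1, h2]
        _ = C * Q y := by
            rw [expect_sum]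
            have : ∀ K ∈ powersetCard k (univ : Finset (Fin n)),
                (expect p fun X => if outcome X K = y then (1 : ℝ) else 0) = Q y := by
              intro K hK
              rw [expect_outcome_eq, (mem_powersetCard.1 hK).2]
            rw [sum_congr rfl this]
            simp [hCdef]
    by_cases hcq : C * Q y ≤ 1
    · refine hle2.trans ?_
      have := Real.rpow_le_rpow_of_exponent_ge' (mul_nonneg hC.le (hQ0 y)) hcq hs0.le hs1
      rwa [Real.rpow_one] at this
    · exact hle1.trans (Real.one_le_rpow (le_of_not_ge hcq) hs0.le)
  rw [h1]
  calc _ ≤ 1 / C * ∑ y : Fin T → Bool, (C * Q y) ^ s :=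
        mul_le_mul_of_nonneg_left (sum_le_sum fun y _ => h2 y) (by positivity)
    _ = C ^ (s - 1) * ∑ y : Fin T → Bool, (Q y) ^ s := by
        rw [Real.rpow_sub_one hC.ne', mul_sum, mul_sum]
        refine sum_congr rfl fun y _ => ?_
        rw [Real.mul_rpow hC.le (hQ0 y)]
        ring
    _ = C ^ (s - 1) * (a ^ s + (1 - a) ^ s) ^ T := by
        congr 1
        have hb : a ^ s + (1 - a) ^ s
            = ∑ b : Bool, (if b = true then (1 - a) ^ s else a ^ s) := by
          simp [add_comm]
        have hpow : (a ^ s + (1 - a) ^ s) ^ T = ∏ _t : Fin T, (a ^ s + (1 - a) ^ s) := by simp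
        rw [hpow, hb, prod_univ_sum, Fintype.piFinset_univ]
        refine sum_congr rfl fun y _ => ?_
        rw [← Real.finsetProd_rpow]
        · refine prod_congr rfl fun t _ => ?_
          split_ifs <;> rfl
        · intro t _
          split_ifs
          · linarith
          · exact ha0

/-- Two further sets of the same size as `K` have the same outcomes as `K`. -/
def Confusable (X : TestDesign n T) (K : Finset (Fin n)) : Prop :=
  ∃ K₁ K₂ : Finset (Fin n), K₁ ≠ K ∧ K₂ ≠ K ∧ K₁ ≠ K₂ ∧ K₁.card = K.card ∧ K₂.card = K.card ∧
    outcome X K₁ = outcome X K ∧ outcome X K₂ = outcome X K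

open Classical in
/-- If, up to probability `B`, the defective set shares its outcomes with at least two other sets
of the same size, then the detection is correct with probability at most `1 / 3 + B`. -/
theorem one_sub_errorProb_le_of_confusable {k : ℕ} (hk : k ≤ n) {p : ℝ}
    (hp : p ∈ Set.Icc (0 : ℝ) 1) (D : DetectionAlgorithm n T) {B : ℝ}
    (hB : ∀ K : Finset (Fin n), K.card = k →
      (expect p fun X : TestDesign n T => if Confusable X K then 0 else 1) ≤ B) :
    1 - errorProb k p D ≤ 1 / 3 + B := by
  have hC : (0 : ℝ) < (n.choose k : ℝ) := by exact_mod_cast Nat.choose_pos hk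
  rw [one_sub_errorProb hk]
  set P := powersetCard k (univ : Finset (Fin n)) with hP
  have hcardP : P.card = n.choose k := by simp [hP]
  have hkey : ∀ X : TestDesign n T,
      3 * (P.filter fun K => D X (outcome X K) = K ∧ Confusable X K).card ≤ n.choose k := by
    intro X
    set A := P.filter fun K => D X (outcome X K) = K ∧ Confusable X K with hA
    have h1 : ∀ K ∈ A, 3 ≤ (P.filter fun K' => outcome X K' = outcome X K).card := by
      intro K hK
      obtain ⟨hKP, -, K₁, K₂, h1, h2, h3, h4, h5, h6, h7⟩ := mem_filter.1 hK
      have hKc : K.card = k := (mem_powersetCard.1 hKP).2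
      have hsub : ({K, K₁, K₂} : Finset (Finset (Fin n))) ⊆
          P.filter fun K' => outcome X K' = outcome X K := by
        intro K' hK'
        simp only [mem_insert, mem_singleton] at hK'
        rw [mem_filter, hP, mem_powersetCard]
        rcases hK' with rfl | rfl | rfl
        · exact ⟨⟨subset_univ _, hKc⟩, rfl⟩
        · exact ⟨⟨subset_univ _, h4.trans hKc⟩, h6⟩
        · exact ⟨⟨subset_univ _, h5.trans hKc⟩, h7⟩
      calc 3 = ({K, K₁, K₂} : Finset (Finset (Fin n))).card :=
            (card_eq_three.2 ⟨K, K₁, K₂, h1.symm, h2.symm, h3, rfl⟩).symm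
        _ ≤ _ := card_le_card hsub
    calc 3 * A.card = ∑ K ∈ A, 3 := by rw [sum_const, smul_eq_mul, mul_comm]
      _ ≤ ∑ K ∈ A, (P.filter fun K' => outcome X K' = outcome X K).card := sum_le_sum h1
      _ = ∑ K' ∈ P, (A.filter fun K => outcome X K' = outcome X K).card :=
          sum_card_bipartiteAbove_eq_sum_card_bipartiteBelow _
      _ ≤ ∑ K' ∈ P, 1 := by
          -- a correctly detected set is determined by its outcomes
          refine sum_le_sum fun K' _ => card_le_one.2 fun K₁ hK₁ K₂ hK₂ => ?_
          obtain ⟨h1, h2⟩ := mem_filter.1 hK₁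
          obtain ⟨h3, h4⟩ := mem_filter.1 hK₂
          rw [← (mem_filter.1 h1).2.1, ← (mem_filter.1 h3).2.1, ← h2, ← h4]
      _ = n.choose k := by rw [sum_const, smul_eq_mul, mul_one, hcardP]
  have hsum : ∑ K ∈ P, (expect p fun X => if D X (outcome X K) = K then (1 : ℝ) else 0)
      ≤ (n.choose k : ℝ) / 3 + (n.choose k : ℝ) * B := by
    calc _ ≤ ∑ K ∈ P, ((expect p fun X : TestDesign n T =>
              if D X (outcome X K) = K ∧ Confusable X K then (1 : ℝ) else 0)
              + expect p fun X : TestDesign n T => if Confusable X K then (0 : ℝ) else 1) := by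
          refine sum_le_sum fun K _ => ?_
          rw [← expect_add]
          refine expect_mono hp fun X => ?_
          by_cases h1 : D X (outcome X K) = K <;> by_cases h2 : Confusable X K <;> simp [h1, h2]
      _ = (expect p fun X : TestDesign n T => ∑ K ∈ P,
              if D X (outcome X K) = K ∧ Confusable X K then (1 : ℝ) else 0)
            + ∑ K ∈ P, expect p fun X : TestDesign n T =>
                if Confusable X K then (0 : ℝ) else 1 := by
          rw [sum_add_distrib, expect_sum]
      _ ≤ (n.choose k : ℝ) / 3 + (n.choose k : ℝ) * B := by
          refine add_le_add ?_ ?_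
          · rw [← expect_const (n := n) (T := T) p ((n.choose k : ℝ) / 3)]
            refine expect_mono hp fun X => ?_
            rw [sum_boole, le_div_iff₀ (by norm_num), mul_comm]
            exact_mod_cast hkey X
          · calc _ ≤ ∑ K ∈ P, B := sum_le_sum fun K hK => hB K (mem_powersetCard.1 hK).2
              _ = _ := by rw [sum_const, nsmul_eq_mul, hcardP]
  calc _ ≤ 1 / (n.choose k : ℝ) * ((n.choose k : ℝ) / 3 + (n.choose k : ℝ) * B) :=
        mul_le_mul_of_nonneg_left hsum (by positivity)
    _ = 1 / 3 + B := by field_simp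

/-! ### Confusable defective sets -/

/-- A second-moment bound: a sum of pairwise nearly uncorrelated indicators `A i` of probability `μ`
is rarely at most `1`. -/
theorem expect_sum_le_one_le {ι : Type*} [DecidableEq ι] {p : ℝ} (hp : p ∈ Set.Icc (0 : ℝ) 1)
    (I : Finset ι) (A : ι → TestDesign n T → ℝ) {μ η : ℝ} (hη : 0 ≤ η)
    (hA0 : ∀ i ∈ I, ∀ X, A i X * A i X = A i X)
    (hA : ∀ i ∈ I, expect p (A i) = μ)
    (hAA : ∀ i ∈ I, ∀ j ∈ I, i ≠ j → (expect p fun X => A i X * A j X) ≤ (1 + η) * μ ^ 2)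
    (hm : 2 ≤ (I.card : ℝ) * μ) :
    (expect p fun X => if ∑ i ∈ I, A i X ≤ 1 then 1 else 0)
      ≤ 4 * (1 / ((I.card : ℝ) * μ) + η) := by
  set m := (I.card : ℝ) * μ with hmdef
  have hm0 : 0 < m := by linarith
  have hμ : 0 ≤ μ := by
    by_contra h
    have : m ≤ 0 := mul_nonpos_of_nonneg_of_nonpos (by positivity) (le_of_not_ge h)
    linarith
  have hN1 : (expect p fun X => ∑ i ∈ I, A i X) = m := by
    rw [expect_sum, sum_congr rfl hA, sum_const, nsmul_eq_mul]
  have hN2 : (expect p fun X => (∑ i ∈ I, A i X) * ∑ i ∈ I, A i X) ≤ m + (1 + η) * m ^ 2 := by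
    have h1 : ∀ i ∈ I, ∀ j ∈ I, (expect p fun X => A i X * A j X)
        ≤ (1 + η) * μ ^ 2 + if i = j then μ else 0 := by
      intro i hi j hj
      by_cases hij : i = j
      · subst hij
        simp only [hA0 i hi, if_true]
        have h2 : (expect p fun X => A i X) = μ := hA i hi
        rw [h2]
        nlinarith [mul_nonneg hη (sq_nonneg μ), sq_nonneg μ]
      · rw [if_neg hij, add_zero]
        exact hAA i hi j hj hij
    simp only [sum_mul_sum]
    rw [expect_sum]
    calc _ = ∑ i ∈ I, ∑ j ∈ I, expect p fun X => A i X * A j X :=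
          sum_congr rfl fun i _ => expect_sum _ _ _
      _ ≤ ∑ i ∈ I, ∑ j ∈ I, ((1 + η) * μ ^ 2 + if i = j then μ else 0) :=
          sum_le_sum fun i hi => sum_le_sum fun j hj => h1 i hi j hj
      _ = m + (1 + η) * m ^ 2 := by
          simp only [sum_add_distrib, sum_const, sum_ite_eq, nsmul_eq_mul]
          rw [sum_congr rfl fun i hi => if_pos hi, sum_const, nsmul_eq_mul, hmdef]
          ring
  calc (expect p fun X => if ∑ i ∈ I, A i X ≤ 1 then (1 : ℝ) else 0)
      ≤ expect p fun X => 4 + (-(8 / m)) * (∑ i ∈ I, A i X)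
          + (4 / m ^ 2) * ((∑ i ∈ I, A i X) * ∑ i ∈ I, A i X) := by
        refine expect_mono hp fun X => ?_
        set N := ∑ i ∈ I, A i X
        have h1 : 4 + (-(8 / m)) * N + (4 / m ^ 2) * (N * N) = 4 * (1 - N / m) ^ 2 := by
          field_simp; ring
        rw [h1]
        split_ifs with h
        · have h2 : N / m ≤ 1 / 2 := by
            rw [div_le_div_iff₀ hm0 (by norm_num)]
            linarith
          nlinarith
        · positivity
    _ = 4 + (-(8 / m)) * m
          + (4 / m ^ 2) * expect p fun X => (∑ i ∈ I, A i X) * ∑ i ∈ I, A i X := by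
        rw [expect_add, expect_add, expect_const, expect_const_mul, expect_const_mul, hN1]
    _ ≤ 4 + (-(8 / m)) * m + (4 / m ^ 2) * (m + (1 + η) * m ^ 2) := by
        gcongr
    _ = 4 * (1 / m + η) := by
        field_simp; ring

/-- The indicator that the defective sets `S` and `S'` have the same outcomes. -/
noncomputable def sameOutcome (S S' : Finset (Fin n)) (X : TestDesign n T) : ℝ :=
  if outcome X S = outcome X S' then 1 else 0

theorem sameOutcome_eq_prod {S S' : Finset (Fin n)} (h : S ⊆ S') (X : TestDesign n T) :
    sameOutcome S S' X
      = ∏ t, (1 - (absent S (fun i => X i t) - absent S' (fun i => X i t))) := by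
  have key : ∀ t, absent S (fun i => X i t) = absent S' (fun i => X i t) ↔
      outcome X S t = outcome X S' t := by
    intro t
    have e : outcome X S t = outcome X S' t ↔
        ((∀ i ∈ S, X i t = false) ↔ ∀ i ∈ S', X i t = false) := by
      rw [← outcome_eq_false_iff, ← outcome_eq_false_iff]
      cases outcome X S t <;> cases outcome X S' t <;> simp
    rw [e]
    have key' : ∀ (P Q : Prop) [Decidable P] [Decidable Q],
        ((if P then (1 : ℝ) else 0) = if Q then 1 else 0) ↔ (P ↔ Q) := by
      intro P Q _ _
      by_cases h1 : P <;> by_cases h2 : Q <;> simp [h1, h2]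
    exact key' _ _
  unfold sameOutcome
  split_ifs with hX
  · symm
    refine prod_eq_one fun t _ => ?_
    rw [(key t).2 (by rw [hX])]
    ring
  · obtain ⟨t, ht⟩ := Function.ne_iff.1 hX
    symm
    refine prod_eq_zero (mem_univ t) ?_
    have h1 := absent_anti h fun i => X i t
    rcases absent_eq_zero_or_one S (fun i => X i t) with h2 | h2 <;>
      rcases absent_eq_zero_or_one S' (fun i => X i t) with h3 | h3 <;>
      rw [h2, h3] at h1 ⊢
    · exact absurd ((key t).1 (h2.trans h3.symm)) ht
    · linarith
    · ring
    · exact absurd ((key t).1 (h2.trans h3.symm)) ht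

theorem expect_sameOutcome (p : ℝ) {S S' : Finset (Fin n)} (h : S ⊆ S') :
    expect p (sameOutcome (T := T) S S') = (1 - ((1 - p) ^ S.card - (1 - p) ^ S'.card)) ^ T := by
  have h1 := expect_prod (T := T) p
    (fun _ (c : Fin n → Bool) => 1 - (absent S c - absent S' c))
  simp only [testExpect_sub, testExpect_const, testExpect_absent, prod_const, card_univ,
    Fintype.card_fin] at h1
  rw [← h1]
  congr 1
  funext X
  exact sameOutcome_eq_prod h X

theorem sameOutcome_mul_self (S S' : Finset (Fin n)) (X : TestDesign n T) :
    sameOutcome S S' X * sameOutcome S S' X = sameOutcome S S' X := by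
  unfold sameOutcome
  split_ifs <;> simp

/-- The probability that two distinct defective items are both masked, where `i ∈ K` is masked if
its removal from `K` does not change the outcomes. The tests in which `i` is the only defective item are
disjoint from those of `j`. -/
theorem expect_masked_pair (p : ℝ) {K : Finset (Fin n)} {i j : Fin n} (hi : i ∈ K) (hj : j ∈ K)
    (hij : i ≠ j) :
    (expect p fun X : TestDesign n T => sameOutcome (K.erase i) K X * sameOutcome (K.erase j) K X)
      = (1 - 2 * ((1 - p) ^ (K.card - 1) - (1 - p) ^ K.card)) ^ T := by
  have hij' : K.erase i ∪ K.erase j = K := by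
    ext x
    simp only [mem_union, mem_erase]
    constructor
    · rintro (h | h) <;> exact h.2
    · intro hx
      by_cases hxi : x = i
      · right; exact ⟨fun h => hij (hxi.symm.trans h), hx⟩
      · left; exact ⟨hxi, hx⟩
  have h1 := expect_prod (T := T) p
    (fun _ (c : Fin n → Bool) =>
      1 - (absent (K.erase i) c - absent K c) - (absent (K.erase j) c - absent K c))
  simp only [testExpect_sub, testExpect_const, testExpect_absent, prod_const, card_univ,
    Fintype.card_fin, card_erase_of_mem hi, card_erase_of_mem hj] at h1
  have h2 : 1 - 2 * ((1 - p) ^ (K.card - 1) - (1 - p) ^ K.card)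
      = 1 - ((1 - p) ^ (K.card - 1) - (1 - p) ^ K.card)
        - ((1 - p) ^ (K.card - 1) - (1 - p) ^ K.card) := by ring
  rw [h2, ← h1]
  congr 1
  funext X
  rw [sameOutcome_eq_prod (erase_subset _ _), sameOutcome_eq_prod (erase_subset _ _),
    ← prod_mul_distrib]
  refine prod_congr rfl fun t _ => ?_
  set c : Fin n → Bool := fun i => X i t
  have e1 := absent_mul_absent (K.erase i) (K.erase j) c
  have e2 := absent_mul_absent (K.erase i) K c
  have e3 := absent_mul_absent K (K.erase j) c
  have e4 := absent_mul_absent K K c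
  rw [hij'] at e1
  rw [union_eq_right.2 (erase_subset _ _)] at e2
  rw [union_eq_left.2 (erase_subset _ _)] at e3
  rw [union_self] at e4
  linear_combination e1 - e2 - e3 + e4

/-- The probability that two distinct nondefective items both avoid all negative tests: the addition
of such an item to `K` does not change the outcomes. -/
theorem expect_hidden_pair (p : ℝ) {K : Finset (Fin n)} {i j : Fin n} (hi : i ∉ K) (hj : j ∉ K)
    (hij : i ≠ j) :
    (expect p fun X : TestDesign n T => sameOutcome K (insert i K) X * sameOutcome K (insert j K) X)
      = (1 - (1 - p) ^ K.card * (1 - (1 - p) ^ 2)) ^ T := by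
  have hcard : (insert i K ∪ insert j K).card = K.card + 2 := by
    have : insert i K ∪ insert j K = insert i (insert j K) := by
      ext x
      simp only [mem_union, mem_insert]
      tauto
    rw [this, card_insert_of_notMem (by simp [hij, hi]), card_insert_of_notMem hj]
  have h1 := expect_prod (T := T) p
    (fun _ (c : Fin n → Bool) => 1 - (absent K c - absent (insert i K ∪ insert j K) c))
  simp only [testExpect_sub, testExpect_const, testExpect_absent, prod_const, card_univ,
    Fintype.card_fin, hcard] at h1
  have h2 : 1 - (1 - p) ^ K.card * (1 - (1 - p) ^ 2)
      = 1 - ((1 - p) ^ K.card - (1 - p) ^ (K.card + 2)) := by ring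
  rw [h2, ← h1]
  congr 1
  funext X
  rw [sameOutcome_eq_prod (subset_insert _ _), sameOutcome_eq_prod (subset_insert _ _),
    ← prod_mul_distrib]
  refine prod_congr rfl fun t _ => ?_
  set c : Fin n → Bool := fun i => X i t
  have e1 := absent_mul_absent (insert i K) (insert j K) c
  have e2 := absent_mul_absent (insert i K) K c
  have e3 := absent_mul_absent K (insert j K) c
  have e4 := absent_mul_absent K K c
  rw [union_eq_left.2 (subset_insert _ _)] at e2
  rw [union_eq_right.2 (subset_insert _ _)] at e3
  rw [union_self] at e4
  linear_combination e1 - e2 - e3 + e4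

/-- A masked defective item may be exchanged for any nondefective item that avoids all negative
tests. -/
theorem outcome_exchange {X : TestDesign n T} {K : Finset (Fin n)} {i j : Fin n}
    (hi : outcome X (K.erase i) = outcome X K) (hj : outcome X K = outcome X (insert j K)) :
    outcome X (insert j (K.erase i)) = outcome X K := by
  funext t
  have h1 := congrFun hi t
  have h2 := congrFun hj t
  rw [Bool.eq_iff_iff, ← not_iff_not, Bool.not_eq_true, Bool.not_eq_true, outcome_eq_false_iff,
    outcome_eq_false_iff] at h1 h2 ⊢
  simp only [mem_insert, forall_eq_or_imp] at h2 ⊢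
  tauto

theorem confusable_of_masked {X : TestDesign n T} {K : Finset (Fin n)}
    (hW : ¬ ∑ i ∈ K, sameOutcome (K.erase i) K X ≤ 1)
    (hG : ¬ ∑ j ∈ Kᶜ, sameOutcome K (insert j K) X ≤ 1) : Confusable X K := by
  obtain ⟨i, hiK, hi⟩ : ∃ i ∈ K, outcome X (K.erase i) = outcome X K := by
    by_contra! h
    refine hW ((sum_eq_zero fun i hi => ?_).trans_le zero_le_one)
    rw [sameOutcome, if_neg (h i hi)]
  have hG' : 1 < (Kᶜ.filter fun j => outcome X K = outcome X (insert j K)).card := by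
    simp only [sameOutcome, sum_boole, not_le] at hG
    exact_mod_cast hG
  obtain ⟨j₁, h1, j₂, h2, hne⟩ := one_lt_card.1 hG'
  rw [mem_filter, mem_compl] at h1 h2
  have hj : ∀ j ∉ K, insert j (K.erase i) ≠ K ∧ (insert j (K.erase i)).card = K.card := by
    intro j hj
    refine ⟨fun h => hj (h ▸ mem_insert_self _ _), ?_⟩
    rw [card_insert_of_notMem fun h => hj (mem_of_mem_erase h), card_erase_of_mem hiK]
    have := card_pos.2 ⟨i, hiK⟩
    omega
  refine ⟨insert j₁ (K.erase i), insert j₂ (K.erase i), (hj j₁ h1.1).1, (hj j₂ h2.1).1, ?_,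
    (hj j₁ h1.1).2, (hj j₂ h2.1).2, outcome_exchange hi h1.2, outcome_exchange hi h2.2⟩
  intro h
  have h3 : j₁ ∈ insert j₂ (K.erase i) := h ▸ mem_insert_self _ _
  rcases mem_insert.1 h3 with h3 | h3
  · exact hne h3
  · exact h1.1 (mem_of_mem_erase h3)

open Classical in
/-- If the expected numbers of masked defective items and of nondefective items in no negative test
are large, then the defective set is confusable with high probability. -/
theorem expect_not_confusable_le {k : ℕ} (hk : 1 ≤ k) {p : ℝ} (hp : p ∈ Set.Icc (0 : ℝ) 1)
    {η : ℝ} (hη : 0 ≤ η) (hr : p * (1 - p) ^ (k - 1) ≤ 1 / 2)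
    (hηT : (1 - (1 - p) ^ k * (1 - (1 - p) ^ 2)) ^ T
      ≤ (1 + η) * ((1 - p * (1 - p) ^ k) ^ T) ^ 2)
    (hW : 2 ≤ (k : ℝ) * (1 - p * (1 - p) ^ (k - 1)) ^ T)
    (hG : 2 ≤ ((n - k : ℕ) : ℝ) * (1 - p * (1 - p) ^ k) ^ T)
    {K : Finset (Fin n)} (hK : K.card = k) :
    (expect p fun X : TestDesign n T => if Confusable X K then 0 else 1)
      ≤ 4 * (1 / ((k : ℝ) * (1 - p * (1 - p) ^ (k - 1)) ^ T))
        + 4 * (1 / (((n - k : ℕ) : ℝ) * (1 - p * (1 - p) ^ k) ^ T) + η) := by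
  have hKc : Kᶜ.card = n - k := by rw [card_compl, Fintype.card_fin, hK]
  have hr' : (1 - p) ^ (k - 1) - (1 - p) ^ k = p * (1 - p) ^ (k - 1) := by
    obtain ⟨m, rfl⟩ : ∃ m, k = m + 1 := ⟨k - 1, by omega⟩
    rw [Nat.add_sub_cancel]
    ring
  have hr0 : 0 ≤ p * (1 - p) ^ (k - 1) :=
    mul_nonneg hp.1 (pow_nonneg (by linarith [hp.2]) _)
  have h1 := expect_sum_le_one_le hp K (fun i => sameOutcome (T := T) (K.erase i) K)
    (μ := (1 - p * (1 - p) ^ (k - 1)) ^ T) (le_refl 0)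
    (fun i _ X => sameOutcome_mul_self _ _ X)
    (fun i hi => by
      rw [expect_sameOutcome p (erase_subset i K), card_erase_of_mem hi, hK, hr'])
    (fun i hi j hj hij => by
      rw [expect_masked_pair p hi hj hij, hK, hr', add_zero, one_mul, ← pow_mul, mul_comm T,
        pow_mul]
      refine pow_le_pow_left₀ (by linarith) ?_ T
      nlinarith)
    (by rwa [hK])
  have h2 := expect_sum_le_one_le hp Kᶜ (fun j => sameOutcome (T := T) K (insert j K))
    (μ := (1 - p * (1 - p) ^ k) ^ T) hη
    (fun i _ X => sameOutcome_mul_self _ _ X)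
    (fun i hi => by
      rw [expect_sameOutcome p (subset_insert i K), card_insert_of_notMem (mem_compl.1 hi), hK]
      congr 1
      ring)
    (fun i hi j hj hij => by
      rw [expect_hidden_pair p (mem_compl.1 hi) (mem_compl.1 hj) hij, hK]
      exact hηT)
    (by rwa [hKc])
  rw [hK, add_zero] at h1
  rw [hKc] at h2
  refine le_trans ?_ (add_le_add h1 h2)
  rw [← expect_add]
  refine expect_mono hp fun X => ?_
  by_cases hX : Confusable X K
  · rw [if_pos hX]
    refine add_nonneg ?_ ?_ <;> split_ifs <;> norm_num
  · rw [if_neg hX]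
    by_cases h3 : ∑ i ∈ K, sameOutcome (K.erase i) K X ≤ 1
    · rw [if_pos h3]
      split_ifs <;> norm_num
    · by_cases h4 : ∑ j ∈ Kᶜ, sameOutcome K (insert j K) X ≤ 1
      · rw [if_pos h4]
        split_ifs; norm_num
      · exact absurd (confusable_of_masked h3 h4) hX

/-! ### The union bound for the consistent decoder -/

open Classical in
/-- The decoder that returns some set of size `k` consistent with the outcomes, if there is one. -/
noncomputable def consistentDecoder (n T k : ℕ) : DetectionAlgorithm n T := fun X y =>
  if h : ∃ K : Finset (Fin n), K.card = k ∧ outcome X K = y then h.choose else ∅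

/-- The consistent decoder can only err if there is another consistent set of size `k`. -/
theorem exists_of_consistentDecoder_ne {k : ℕ} {X : TestDesign n T} {K : Finset (Fin n)}
    (hK : K.card = k) (h : consistentDecoder n T k X (outcome X K) ≠ K) :
    ∃ K' : Finset (Fin n), K' ≠ K ∧ K'.card = k ∧ outcome X K' = outcome X K := by
  have hex : ∃ K' : Finset (Fin n), K'.card = k ∧ outcome X K' = outcome X K := ⟨K, hK, rfl⟩
  rw [consistentDecoder, dif_pos hex] at h
  exact ⟨hex.choose, h, hex.choose_spec⟩

/-- The conditional probability, given the rows of the defective items in `K`, that a test remains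
consistent when the items of `L ⊆ K` are exchanged for as many nondefective items: `b` is the
probability that the new items avoid the test. -/
noncomputable def exchangeProb (K L : Finset (Fin n)) (b : ℝ) (c : Fin n → Bool) : ℝ :=
  (1 - absent (K \ L) c) + (absent (K \ L) c - absent K c) * (1 - b) + absent K c * b

theorem absent_cases (K L : Finset (Fin n)) (c : Fin n → Bool) :
    (absent (K \ L) c = 0 ∧ absent K c = 0) ∨ (absent (K \ L) c = 1 ∧ absent K c = 0) ∨
      (absent (K \ L) c = 1 ∧ absent K c = 1) := by
  have h1 := absent_anti (sdiff_subset : K \ L ⊆ K) c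
  rcases absent_eq_zero_or_one (K \ L) c with h2 | h2 <;>
    rcases absent_eq_zero_or_one K c with h3 | h3 <;> rw [h2, h3] at h1 <;> simp_all
  linarith

theorem exchangeProb_nonneg (K L : Finset (Fin n)) {b : ℝ} (hb0 : 0 ≤ b) (hb1 : b ≤ 1)
    (c : Fin n → Bool) : 0 ≤ exchangeProb K L b c := by
  unfold exchangeProb
  rcases absent_cases K L c with ⟨h1, h2⟩ | ⟨h1, h2⟩ | ⟨h1, h2⟩ <;> rw [h1, h2] <;> linarith

theorem exchangeProb_rpow (K L : Finset (Fin n)) (b ρ : ℝ) (c : Fin n → Bool) :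
    exchangeProb K L b c ^ ρ = (1 - absent (K \ L) c)
      + (absent (K \ L) c - absent K c) * (1 - b) ^ ρ + absent K c * b ^ ρ := by
  unfold exchangeProb
  rcases absent_cases K L c with ⟨h1, h2⟩ | ⟨h1, h2⟩ | ⟨h1, h2⟩ <;> rw [h1, h2] <;> simp

theorem testExpect_exchangeProb_rpow (p ρ : ℝ) {K L : Finset (Fin n)} (hL : L ⊆ K) :
    testExpect p (fun c => exchangeProb K L ((1 - p) ^ L.card) c ^ ρ)
      = 1 - (1 - p) ^ (K.card - L.card) *
          ((1 - (1 - p) ^ L.card) * (1 - (1 - (1 - p) ^ L.card) ^ ρ)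
            + (1 - p) ^ L.card * (1 - ((1 - p) ^ L.card) ^ ρ)) := by
  have hpow : (1 - p) ^ K.card = (1 - p) ^ (K.card - L.card) * (1 - p) ^ L.card := by
    rw [← pow_add, Nat.sub_add_cancel (card_le_card hL)]
  simp only [exchangeProb_rpow, testExpect_add, testExpect_sub, testExpect_mul_const,
    testExpect_const, testExpect_absent, card_sdiff_of_subset hL]
  rw [hpow]
  ring

theorem expect_exchange_le {p : ℝ} (hp : p ∈ Set.Icc (0 : ℝ) 1) {K L L' : Finset (Fin n)}
    (hL' : Disjoint K L') (Z : TestDesign n T) :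
    (expect p fun Z' : TestDesign n T =>
      if outcome (fun i => if i ∈ K then Z i else Z' i) (K \ L ∪ L')
        = outcome (fun i => if i ∈ K then Z i else Z' i) K then (1 : ℝ) else 0)
      ≤ ∏ t, exchangeProb K L ((1 - p) ^ L'.card) fun i => Z i t := by
  have h := expect_prod (T := T) p (fun t (c' : Fin n → Bool) =>
    (1 - absent (K \ L) fun i => Z i t)
      + (1 - absent L' c') * ((absent (K \ L) fun i => Z i t) - absent K fun i => Z i t)
      + absent L' c' * absent K fun i => Z i t)
  have h2 : ∀ t, testExpect p (fun c' : Fin n → Bool =>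
      (1 - absent (K \ L) fun i => Z i t)
      + (1 - absent L' c') * ((absent (K \ L) fun i => Z i t) - absent K fun i => Z i t)
      + absent L' c' * absent K fun i => Z i t)
      = exchangeProb K L ((1 - p) ^ L'.card) fun i => Z i t := by
    intro t
    simp only [testExpect_add, testExpect_mul_const, testExpect_sub, testExpect_const,
      testExpect_absent, exchangeProb]
    ring
  simp only [h2] at h
  rw [← h]
  refine expect_mono hp fun Z' => ?_
  have hnn : ∀ t, 0 ≤ (1 - absent (K \ L) fun i => Z i t)
      + (1 - absent L' fun i => Z' i t)
        * ((absent (K \ L) fun i => Z i t) - absent K fun i => Z i t)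
      + (absent L' fun i => Z' i t) * absent K fun i => Z i t := by
    intro t
    rcases absent_cases K L (fun i => Z i t) with ⟨h1, h2⟩ | ⟨h1, h2⟩ | ⟨h1, h2⟩ <;>
      rcases absent_eq_zero_or_one L' (fun i => Z' i t) with h3 | h3 <;>
      rw [h1, h2, h3] <;> norm_num
  split_ifs with hX
  · refine le_of_eq (Eq.symm (prod_eq_one fun t _ => ?_))
    have ht : outcome (fun i => if i ∈ K then Z i else Z' i) (K \ L ∪ L') t = false
        ↔ outcome (fun i => if i ∈ K then Z i else Z' i) K t = false := by rw [hX]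
    rw [outcome_eq_false_iff, outcome_eq_false_iff] at ht
    have e1 : (∀ i ∈ K \ L ∪ L', (if i ∈ K then Z i else Z' i) t = false) ↔
        (absent (K \ L) fun i => Z i t) = 1 ∧ (absent L' fun i => Z' i t) = 1 := by
      simp only [absent_eq_one_iff, mem_union, or_imp, forall_and]
      refine and_congr (forall₂_congr fun i hi => ?_) (forall₂_congr fun i hi => ?_)
      · rw [if_pos (mem_sdiff.1 hi).1]
      · rw [if_neg (disjoint_right.1 hL' hi)]
    have e2 : (∀ i ∈ K, (if i ∈ K then Z i else Z' i) t = false) ↔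
        (absent K fun i => Z i t) = 1 := by
      rw [absent_eq_one_iff]
      exact forall₂_congr fun i hi => by rw [if_pos hi]
    rw [e1, e2] at ht
    rcases absent_cases K L (fun i => Z i t) with ⟨h1, h2⟩ | ⟨h1, h2⟩ | ⟨h1, h2⟩ <;>
      rcases absent_eq_zero_or_one L' (fun i => Z' i t) with h3 | h3 <;>
      rw [h1, h2, h3] at ht ⊢ <;> revert ht <;> norm_num
  · exact prod_nonneg fun t _ => hnn t

open Classical in
/-- The exchange of a fixed `L ⊆ K` for some set of nondefective items is consistent with small
probability: conditionally on the rows of `K` this probability is at most `1` and at most the union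
bound over the sets of nondefective items, hence at most the `ρ`-th power of the union bound. -/
theorem expect_exists_exchange_le {p : ℝ} (hp : p ∈ Set.Icc (0 : ℝ) 1) {K L : Finset (Fin n)}
    (hL : L ⊆ K) {ρ : ℝ} (hρ0 : 0 < ρ) (hρ1 : ρ ≤ 1) :
    (expect p fun X : TestDesign n T =>
      if ∃ L' ∈ powersetCard L.card Kᶜ, outcome X (K \ L ∪ L') = outcome X K
        then (1 : ℝ) else 0)
      ≤ ((n - K.card).choose L.card : ℝ) ^ ρ * (1 - (1 - p) ^ (K.card - L.card) *
          ((1 - (1 - p) ^ L.card) * (1 - (1 - (1 - p) ^ L.card) ^ ρ)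
            + (1 - p) ^ L.card * (1 - ((1 - p) ^ L.card) ^ ρ))) ^ T := by
  have hb0 : 0 ≤ (1 - p) ^ L.card := pow_nonneg (by linarith [hp.2]) _
  have hb1 : (1 - p) ^ L.card ≤ 1 := pow_le_one₀ (by linarith [hp.2]) (by linarith [hp.1])
  rw [← testExpect_exchangeProb_rpow p ρ hL, expect_splice p K]
  set N : ℝ := ((n - K.card).choose L.card : ℝ)
  have hN : ((powersetCard L.card Kᶜ).card : ℝ) = N := by
    rw [card_powersetCard, card_compl, Fintype.card_fin]
  have hN0 : 0 ≤ N := Nat.cast_nonneg _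
  have hprod := expect_prod (T := T) p
    (fun _ (c : Fin n → Bool) => exchangeProb K L ((1 - p) ^ L.card) c ^ ρ)
  rw [prod_const, card_univ, Fintype.card_fin] at hprod
  rw [← hprod, ← expect_const_mul]
  refine expect_mono hp fun Z => ?_
  set Q := ∏ t, exchangeProb K L ((1 - p) ^ L.card) fun i => Z i t with hQ
  have hQ0 : 0 ≤ Q := prod_nonneg fun t _ => exchangeProb_nonneg K L hb0 hb1 _
  have hgoal : N ^ ρ * ∏ t, (exchangeProb K L ((1 - p) ^ L.card) fun i => Z i t) ^ ρ
      = (N * Q) ^ ρ := by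
    rw [Real.mul_rpow hN0 hQ0, hQ,
      Real.finsetProd_rpow _ _ fun t _ => exchangeProb_nonneg K L hb0 hb1 _]
  rw [hgoal]
  set E := expect p fun Z' : TestDesign n T =>
      if ∃ L' ∈ powersetCard L.card Kᶜ,
        outcome (fun i => if i ∈ K then Z i else Z' i) (K \ L ∪ L')
          = outcome (fun i => if i ∈ K then Z i else Z' i) K then (1 : ℝ) else 0 with hE
  have hE1 : E ≤ 1 := by
    refine le_of_le_of_eq (expect_mono (G := fun _ => 1) hp fun X => ?_) (expect_const p 1)
    split_ifs <;> norm_num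
  have hE2 : E ≤ N * Q := by
    calc E ≤ expect p fun Z' : TestDesign n T => ∑ L' ∈ powersetCard L.card Kᶜ,
            if outcome (fun i => if i ∈ K then Z i else Z' i) (K \ L ∪ L')
              = outcome (fun i => if i ∈ K then Z i else Z' i) K then (1 : ℝ) else 0 := by
          refine expect_mono hp fun Z' => ?_
          split_ifs with h
          · obtain ⟨L', hL', h⟩ := h
            refine le_trans (le_of_eq ?_) (single_le_sum (fun i _ => ?_) hL')
            · rw [if_pos h]
            · split_ifs <;> norm_num
          · exact sum_nonneg fun i _ => by split_ifs <;> norm_num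
      _ ≤ ∑ L' ∈ powersetCard L.card Kᶜ, Q := by
          rw [expect_sum]
          refine sum_le_sum fun L' hL' => ?_
          rw [mem_powersetCard] at hL'
          have := expect_exchange_le (T := T) hp (L := L)
            (disjoint_right.2 fun i hi => mem_compl.1 (hL'.1 hi) : Disjoint K L') Z
          rwa [hL'.2] at this
      _ = N * Q := by rw [sum_const, nsmul_eq_mul, hN]
  by_cases hNQ : N * Q ≤ 1
  · refine hE2.trans ?_
    have := Real.rpow_le_rpow_of_exponent_ge' (mul_nonneg hN0 hQ0) hNQ hρ0.le hρ1
    rwa [Real.rpow_one] at this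
  · exact hE1.trans (Real.one_le_rpow (le_of_not_ge hNQ) hρ0.le)

/-- The amount `1 - ((1 - b) ^ (1 + ρ) + b ^ (1 + ρ))` by which the `ρ`-th moment of the probability
of a `Bernoulli(b)` outcome falls short of `1`. -/
noncomputable def momentLoss (b ρ : ℝ) : ℝ := (1 - b) * (1 - (1 - b) ^ ρ) + b * (1 - b ^ ρ)

/-- The bound, with exponent `ρ`, on the probability that some exchange of `l` of the `k` defective
items for `l` nondefective ones is consistent with the outcomes. -/
noncomputable def codingTerm (n k T : ℕ) (p ρ : ℝ) (l : ℕ) : ℝ :=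
  (k.choose l : ℝ) * (((n - k).choose l : ℝ) ^ ρ *
    (1 - (1 - p) ^ (k - l) * momentLoss ((1 - p) ^ l) ρ) ^ T)

/-- The random coding bound for the consistent decoder; the exponent `ρ` may depend on the number
`l` of missed defective items. -/
theorem errorProb_consistentDecoder_le {k : ℕ} (hk : k ≤ n) {p : ℝ} (hp : p ∈ Set.Icc (0 : ℝ) 1)
    {ρ : ℕ → ℝ} (hρ0 : ∀ l, 0 < ρ l) (hρ1 : ∀ l, ρ l ≤ 1) :
    errorProb k p (consistentDecoder n T k) ≤
      ∑ l ∈ Icc 1 k, codingTerm n k T p (ρ l) l := by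
  classical
  simp only [codingTerm, momentLoss]
  have hC : (0 : ℝ) < n.choose k := by exact_mod_cast Nat.choose_pos hk
  set B : ℕ → ℝ := fun l => (((n - k).choose l : ℝ) ^ ρ l * (1 - (1 - p) ^ (k - l) *
          ((1 - (1 - p) ^ l) * (1 - (1 - (1 - p) ^ l) ^ ρ l)
            + (1 - p) ^ l * (1 - ((1 - p) ^ l) ^ ρ l))) ^ T) with hB
  have hgiven : ∀ K ∈ powersetCard k (univ : Finset (Fin n)),
      errorProbGiven p (consistentDecoder n T k) K ≤ ∑ l ∈ Icc 1 k, (k.choose l : ℝ) * B l := by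
    intro K hK
    have hKc := (mem_powersetCard.1 hK).2
    rw [errorProbGiven_eq]
    calc _ ≤ expect p fun X : TestDesign n T => ∑ l ∈ Icc 1 k, ∑ L ∈ powersetCard l K,
            if ∃ L' ∈ powersetCard L.card Kᶜ, outcome X (K \ L ∪ L') = outcome X K
              then (1 : ℝ) else 0 := by
          refine expect_mono hp fun X => ?_
          split_ifs with h
          · obtain ⟨K', hne, hK'c, hK'⟩ := exists_of_consistentDecoder_ne hKc h
            have hcard : (K' \ K).card = (K \ K').card :=
              card_sdiff_comm (hK'c.trans hKc.symm)
            have hl : (K \ K').card ∈ Icc 1 k := by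
              rw [mem_Icc]
              refine ⟨card_pos.2 ?_, (card_le_card sdiff_subset).trans hKc.le⟩
              rw [sdiff_nonempty]
              intro hsub
              exact hne (eq_of_subset_of_card_le hsub (hK'c.trans hKc.symm).le).symm
            refine le_trans ?_ (single_le_sum (fun l _ => sum_nonneg fun L _ => ?_) hl)
            · refine le_trans (le_of_eq ?_) (single_le_sum (fun L _ => ?_)
                (mem_powersetCard.2 ⟨sdiff_subset, rfl⟩ : K \ K' ∈ powersetCard _ K))
              · rw [if_pos]
                refine ⟨K' \ K, mem_powersetCard.2 ⟨fun i hi => ?_, hcard⟩, ?_⟩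
                · exact mem_compl.2 (mem_sdiff.1 hi).2
                · have : K \ (K \ K') ∪ K' \ K = K' := by
                    ext i
                    simp only [mem_union, Finset.mem_sdiff]
                    tauto
                  rw [this, hK']
              · split_ifs <;> norm_num
            · split_ifs <;> norm_num
          · exact sum_nonneg fun l _ => sum_nonneg fun L _ => by split_ifs <;> norm_num
      _ ≤ ∑ l ∈ Icc 1 k, ∑ L ∈ powersetCard l K, B l := by
          rw [expect_sum]
          refine sum_le_sum fun l _ => ?_
          rw [expect_sum]
          refine sum_le_sum fun L hL => ?_
          rw [mem_powersetCard] at hL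
          have := expect_exists_exchange_le (T := T) hp hL.1 (hρ0 l) (hρ1 l)
          rw [hL.2, hKc] at this
          rw [hL.2]
          exact this
      _ = _ := by
          refine sum_congr rfl fun l _ => ?_
          rw [sum_const, card_powersetCard, hKc, nsmul_eq_mul]
  calc errorProb k p (consistentDecoder n T k)
      ≤ 1 / (n.choose k : ℝ) * ∑ K ∈ powersetCard k (univ : Finset (Fin n)),
          ∑ l ∈ Icc 1 k, (k.choose l : ℝ) * B l :=
        mul_le_mul_of_nonneg_left (sum_le_sum hgiven) (by positivity)
    _ = _ := by
        rw [sum_const, card_powersetCard, card_univ, Fintype.card_fin, nsmul_eq_mul,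
          one_div, inv_mul_cancel_left₀ hC.ne']

end Design

open Real

/-! ### Entropy and the two bounds -/

theorem binaryEntropy_eq (x : ℝ) : binaryEntropy x = binEntropy x / log 2 := by
  unfold binaryEntropy binEntropy logb
  rw [one_div, one_div]
  ring

/-- In nats: the second bound compares `log (n choose k)` with the entropy of a test. -/
theorem testsAt_eq (n k : ℕ) (ν : ℝ) :
    testsAt n k ν = max ((k : ℝ) * log k / (ν * exp (-ν)))
      (log (n.choose k) / binEntropy (exp (-ν))) := by
  have h2 : log 2 ≠ 0 := (log_pos one_lt_two).ne'
  unfold testsAt logChoose logb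
  rw [binaryEntropy_eq, one_div_mul_eq_div, one_div_div, ← mul_div_mul_comm]
  congr 1
  rw [mul_comm (binEntropy _), mul_div_mul_left _ _ h2]

theorem exp_neg_mem_Ioo {ν : ℝ} (h : 0 < ν) : exp (-ν) ∈ Set.Ioo (0 : ℝ) 1 :=
  ⟨exp_pos _, by rw [exp_lt_one_iff]; linarith⟩

theorem binEntropy_exp_neg_pos {ν : ℝ} (h : 0 < ν) : 0 < binEntropy (exp (-ν)) :=
  binEntropy_pos (exp_neg_mem_Ioo h).1 (exp_neg_mem_Ioo h).2

theorem log_two_le_one : log 2 ≤ 1 := by linarith [log_two_lt_d9]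

/-- Both bounds improve when `ν` is moved into the interval `[log 2, 1]` between the maximizers of
the entropy of a test and of `ν * exp (-ν)`. -/
theorem exists_mem_Icc_le (ν : ℝ) : ∃ ν' ∈ Set.Icc (log 2) 1,
    ν * exp (-ν) ≤ ν' * exp (-ν') ∧ binEntropy (exp (-ν)) ≤ binEntropy (exp (-ν')) := by
  have hl := log_two_le_one
  have hl0 : 0 < log 2 := log_pos one_lt_two
  rcases lt_or_ge ν (log 2) with h1 | h1
  · refine ⟨log 2, ⟨le_rfl, hl⟩, ?_, ?_⟩
    · have h2 : exp (-ν) = exp (-log 2) * exp (log 2 - ν) := by rw [← exp_add]; ring_nf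
      have h4 : exp (log 2 - ν) * (1 - (log 2 - ν)) ≤ 1 := by
        have h6 := add_one_le_exp (-(log 2 - ν))
        calc exp (log 2 - ν) * (1 - (log 2 - ν))
            ≤ exp (log 2 - ν) * exp (-(log 2 - ν)) := by gcongr; linarith
          _ = 1 := by rw [← exp_add]; simp
      have h5 : ν * exp (log 2 - ν) ≤ log 2 := by
        have h7 : ν ≤ log 2 * (1 - (log 2 - ν)) := by nlinarith
        calc ν * exp (log 2 - ν) ≤ (log 2 * (1 - (log 2 - ν))) * exp (log 2 - ν) := by gcongr
          _ = log 2 * (exp (log 2 - ν) * (1 - (log 2 - ν))) := by ring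
          _ ≤ log 2 := by nlinarith
      rw [h2]
      calc ν * (exp (-log 2) * exp (log 2 - ν)) = (ν * exp (log 2 - ν)) * exp (-log 2) := by ring
        _ ≤ log 2 * exp (-log 2) := by gcongr
    · rw [exp_neg (log 2), exp_log two_pos, binEntropy_two_inv]
      exact binEntropy_le_log_two
  · rcases le_or_gt ν 1 with h2 | h2
    · exact ⟨ν, ⟨h1, h2⟩, le_rfl, le_rfl⟩
    · refine ⟨1, ⟨hl, le_rfl⟩, ?_, ?_⟩
      · have h3 := add_one_le_exp (ν - 1)
        calc ν * exp (-ν) ≤ exp (ν - 1) * exp (-ν) := by gcongr; linarith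
          _ = 1 * exp (-1) := by rw [← exp_add, one_mul]; ring_nf
      · have h3 : exp (-1) ≤ (2 : ℝ)⁻¹ := by
          rw [exp_neg]
          exact inv_anti₀ two_pos (by linarith [add_one_le_exp (1 : ℝ)])
        refine binEntropy_strictMonoOn.monotoneOn ⟨(exp_pos _).le, ?_⟩ ⟨(exp_pos _).le, h3⟩ ?_
        · exact (exp_le_exp.2 (by linarith)).trans h3
        · exact exp_le_exp.2 (by linarith)

theorem pos_of_mem_Icc {ν : ℝ} (h : ν ∈ Set.Icc (log 2) 1) : 0 < ν :=
  lt_of_lt_of_le (log_pos one_lt_two) h.1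

theorem log_cast_nonneg (m : ℕ) : 0 ≤ log (m : ℝ) := log_natCast_nonneg m

/-- The minimum over `ν > 0` of the maximum of two bounds with nonnegative numerators is attained at
some `ν ∈ [log 2, 1]`. -/
theorem exists_forall_max_div_le {x y : ℝ} (hx : 0 ≤ x) (hy : 0 ≤ y) :
    ∃ ν ∈ Set.Icc (log 2) 1, ∀ ν', 0 < ν' →
      max (x / (ν * exp (-ν))) (y / binEntropy (exp (-ν)))
        ≤ max (x / (ν' * exp (-ν'))) (y / binEntropy (exp (-ν'))) := by
  have hcont : ContinuousOn (fun ν => max (x / (ν * exp (-ν))) (y / binEntropy (exp (-ν))))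
      (Set.Icc (log 2) 1) := by
    refine ContinuousOn.sup (ContinuousOn.div₀ (by fun_prop) (by fun_prop) fun ν hν => ?_)
      (ContinuousOn.div₀ (by fun_prop) ?_ fun ν hν => ?_)
    · exact (mul_pos (pos_of_mem_Icc hν) (exp_pos _)).ne'
    · exact (binEntropy_continuous.comp
        (by fun_prop : Continuous fun ν : ℝ => exp (-ν))).continuousOn
    · exact (binEntropy_exp_neg_pos (pos_of_mem_Icc hν)).ne'
  obtain ⟨ν, hν, hmin⟩ := isCompact_Icc.exists_isMinOn ⟨1, log_two_le_one, le_rfl⟩ hcont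
  refine ⟨ν, hν, fun ν' hν' => ?_⟩
  obtain ⟨ν'', h1, h2, h3⟩ := exists_mem_Icc_le ν'
  exact (hmin h1).trans (max_le_max (div_le_div_of_nonneg_left hx (mul_pos hν' (exp_pos _)) h2)
    (div_le_div_of_nonneg_left hy (binEntropy_exp_neg_pos hν') h3))

/-- The threshold `T*` is attained at some `ν ∈ [log 2, 1]`. -/
theorem exists_Tstar_eq (n k : ℕ) : ∃ ν ∈ Set.Icc (log 2) 1, Tstar n k = testsAt n k ν ∧
    ∀ ν', 0 < ν' → testsAt n k ν ≤ testsAt n k ν' := by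
  obtain ⟨ν, hν, hmin⟩ := exists_forall_max_div_le
    (mul_nonneg (Nat.cast_nonneg k) (log_cast_nonneg k)) (log_cast_nonneg (n.choose k))
  have hall : ∀ ν', 0 < ν' → testsAt n k ν ≤ testsAt n k ν' := by
    intro ν' hν'
    rw [testsAt_eq, testsAt_eq]
    exact hmin ν' hν'
  refine ⟨ν, hν, ?_, hall⟩
  refine IsLeast.csInf_eq ⟨⟨ν, pos_of_mem_Icc hν, rfl⟩, ?_⟩
  rintro _ ⟨ν', hν', rfl⟩
  exact hall ν' hν'

theorem isLeast_Tstar (n k : ℕ) : IsLeast (testsAt n k '' Set.Ioi 0) (Tstar n k) := by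
  obtain ⟨ν, hν, h1, h2⟩ := exists_Tstar_eq n k
  rw [h1]
  refine ⟨⟨ν, pos_of_mem_Icc hν, rfl⟩, ?_⟩
  rintro _ ⟨ν', hν', rfl⟩
  exact h2 ν' hν'

/-- The function `u ↦ exp u * binEntropy (exp (-u))` is concave. -/
theorem concaveOn_exp_mul_binEntropy :
    ConcaveOn ℝ (Set.Ici 0) fun u : ℝ => exp u * binEntropy (exp (-u)) := by
  have hderiv : ∀ u : ℝ, 0 < u → HasDerivAt (fun u : ℝ => exp u * binEntropy (exp (-u)))
      (-(exp u * log (1 - exp (-u)))) u := by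
    intro u hu
    obtain ⟨hx0, hx1⟩ := exp_neg_mem_Ioo hu
    have h1 : HasDerivAt (fun u : ℝ => exp (-u)) (-exp (-u)) u := by
      have := (hasDerivAt_neg u).exp
      simpa using this
    have h2 := (hasDerivAt_binEntropy hx0.ne' hx1.ne).comp u h1
    have h3 : HasDerivAt (fun u : ℝ => exp u * binEntropy (exp (-u))) _ u :=
      (hasDerivAt_exp u).mul h2
    refine h3.congr_deriv ?_
    simp only [binEntropy, log_inv, log_exp]
    ring
  refine AntitoneOn.concaveOn_of_deriv (convex_Ici 0)
    (continuous_exp.mul (binEntropy_continuous.comp (by fun_prop))).continuousOn ?_ ?_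
  · rw [interior_Ici]
    exact fun u hu => (hderiv u hu).differentiableAt.differentiableWithinAt
  · rw [interior_Ici]
    intro u hu v hv huv
    rw [(hderiv u hu).deriv, (hderiv v hv).deriv, neg_le_neg_iff]
    obtain ⟨hx0, hx1⟩ := exp_neg_mem_Ioo hu
    obtain ⟨hy0, hy1⟩ := exp_neg_mem_Ioo hv
    -- concavity of the logarithm between `1 - exp (-u)` and `1`, at the point `1 - exp (-v)`
    have hxy : exp (u - v) ≤ 1 := exp_le_one_iff.2 (by linarith)
    have h1 := strictConcaveOn_log_Ioi.concaveOn.2 (x := 1 - exp (-u)) (y := 1)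
      (by simpa using hx1) (by simp) (exp_pos (u - v)).le (sub_nonneg.2 hxy) (by ring)
    have e1 : exp (u - v) * exp (-u) = exp (-v) := by rw [← exp_add]; ring_nf
    have e2 : exp (u - v) * (1 - exp (-u)) + (1 - exp (u - v)) * 1 = 1 - exp (-v) := by
      linear_combination -e1
    simp only [smul_eq_mul, log_one, mul_zero, add_zero] at h1
    rw [e2] at h1
    have e3 : exp v * exp (u - v) = exp u := by rw [← exp_add]; ring_nf
    calc exp u * log (1 - exp (-u)) = exp v * (exp (u - v) * log (1 - exp (-u))) := by
          rw [← mul_assoc, e3]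
      _ ≤ exp v * log (1 - exp (-v)) := by gcongr

/-- The information about a fraction `α` of the defective items, given the others, is at least the
fraction `α` of the information about all of them. -/
theorem mul_binEntropy_le {u α : ℝ} (hu : 0 ≤ u) (h0 : 0 ≤ α) (h1 : α ≤ 1) :
    α * binEntropy (exp (-u)) ≤ exp (-(u - α * u)) * binEntropy (exp (-(α * u))) := by
  have h := concaveOn_exp_mul_binEntropy.2 (x := u) (y := 0) hu (by simp) h0
    (sub_nonneg.2 h1) (by ring)
  simp only [smul_eq_mul, mul_zero, add_zero, neg_zero, exp_zero, binEntropy_one] at h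
  have e1 : exp (-u) * exp u = 1 := by rw [← exp_add]; simp
  have e2 : exp (-u) * exp (α * u) = exp (-(u - α * u)) := by rw [← exp_add]; ring_nf
  calc α * binEntropy (exp (-u))
      = exp (-u) * (α * (exp u * binEntropy (exp (-u)))) := by
        linear_combination -(α * binEntropy (exp (-u))) * e1
    _ ≤ exp (-u) * (exp (α * u) * binEntropy (exp (-(α * u)))) := by gcongr
    _ = _ := by rw [← mul_assoc, e2]

/-! ### Binomial coefficients -/

theorem div_pow_le_choose {n k : ℕ} (hk : k ≤ n) : ((n : ℝ) / k) ^ k ≤ n.choose k := by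
  induction k generalizing n with
  | zero => simp
  | succ k ih =>
    obtain ⟨m, rfl⟩ : ∃ m, n = m + 1 := ⟨n - 1, by omega⟩
    have hkm : k ≤ m := by omega
    have h1 := ih hkm
    have h2 : (((m + 1 : ℕ) : ℝ)) * m.choose k = (m + 1).choose (k + 1) * ((k + 1 : ℕ) : ℝ) := by
      exact_mod_cast Nat.add_one_mul_choose_eq m k
    have hk1 : (0 : ℝ) < ((k + 1 : ℕ) : ℝ) := by positivity
    have h3 : ((m + 1).choose (k + 1) : ℝ)
        = ((m + 1 : ℕ) : ℝ) / ((k + 1 : ℕ) : ℝ) * m.choose k := by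
      field_simp
      linarith
    rw [h3, pow_succ']
    refine mul_le_mul_of_nonneg_left (le_trans ?_ h1) (by positivity)
    rcases Nat.eq_zero_or_pos k with rfl | hk0
    · simp
    · have hk0' : (0 : ℝ) < k := by exact_mod_cast hk0
      refine pow_le_pow_left₀ (by positivity) ?_ k
      rw [div_le_div_iff₀ hk1 hk0']
      push_cast
      have : (k : ℝ) ≤ m := by exact_mod_cast hkm
      nlinarith

theorem le_choose {n k : ℕ} (h1 : 1 ≤ k) (hk : k < n) : n ≤ n.choose k := by
  induction n generalizing k with
  | zero => omega
  | succ n ih =>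
    obtain ⟨m, rfl⟩ : ∃ m, k = m + 1 := ⟨k - 1, by omega⟩
    rw [Nat.choose_succ_succ]
    have h3 : 0 < n.choose (m + 1) := Nat.choose_pos (by omega)
    rcases Nat.eq_zero_or_pos m with rfl | hm
    · simp
    · have := ih hm (by omega)
      rw [Nat.succ_eq_add_one]
      omega

theorem mul_log_le_log_choose {n k : ℕ} (h0 : 1 ≤ k) (hk : k ≤ n) :
    (k : ℝ) * log (n / k) ≤ log (n.choose k) := by
  have hk0 : (0 : ℝ) < k := by exact_mod_cast h0
  have hn0 : (0 : ℝ) < n := by exact_mod_cast h0.trans hk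
  rw [← log_pow]
  exact log_le_log (by positivity) (div_pow_le_choose hk)

theorem log_le_log_choose {n k : ℕ} (h0 : 1 ≤ k) (hk : k < n) :
    log n ≤ log (n.choose k) :=
  log_le_log (by exact_mod_cast (by omega : 0 < n)) (by exact_mod_cast le_choose h0 hk)

theorem choose_le_exp {m l : ℕ} (hm : 1 ≤ m) (hl : 1 ≤ l) :
    (m.choose l : ℝ) ≤ exp (l * (log (m / l) + 1)) := by
  have hl0 : (0 : ℝ) < l := by exact_mod_cast hl
  have hm0 : (0 : ℝ) < m := by exact_mod_cast hm
  have h1 : (m.choose l : ℝ) ≤ (m : ℝ) ^ l / (l.factorial : ℝ) := Nat.choose_le_pow_div l m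
  have h2 : (l : ℝ) ^ l / (l.factorial : ℝ) ≤ exp l := pow_div_factorial_le_exp (l : ℝ) hl0.le l
  have h3 : exp (l * (log (m / l) + 1)) = ((m : ℝ) / l) ^ l * exp l := by
    rw [mul_add, mul_one, exp_add, mul_comm (l : ℝ) (log _), ← rpow_def_of_pos (by positivity),
      rpow_natCast]
  rw [h3]
  calc (m.choose l : ℝ) ≤ (m : ℝ) ^ l / (l.factorial : ℝ) := h1
    _ = ((m : ℝ) / l) ^ l * ((l : ℝ) ^ l / (l.factorial : ℝ)) := by
        rw [div_pow]; field_simp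
    _ ≤ _ := by gcongr

/-- Up to `exp (2 * k)`, the number of exchanges of `l` of the `k` defective items is at most the
power `l / k` of the number of defective sets. -/
theorem choose_sub_le_exp {n k l : ℕ} (hl : 1 ≤ l) (hlk : l ≤ k) (hk : k ≤ n) :
    ((n - k).choose l : ℝ) ≤ exp ((l : ℝ) / k * log (n.choose k) + 2 * k) := by
  have hl0 : (0 : ℝ) < l := by exact_mod_cast hl
  have hk0 : (0 : ℝ) < k := by exact_mod_cast hl.trans hlk
  have hn0 : (0 : ℝ) < n := by exact_mod_cast hl.trans (hlk.trans hk)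
  have hlk' : (l : ℝ) ≤ k := by exact_mod_cast hlk
  calc ((n - k).choose l : ℝ) ≤ (n.choose l : ℝ) := by
        exact_mod_cast Nat.choose_le_choose l (Nat.sub_le n k)
    _ ≤ exp (l * (log (n / l) + 1)) := choose_le_exp (hl.trans (hlk.trans hk)) hl
    _ ≤ _ := by
        rw [exp_le_exp]
        have e1 : log ((n : ℝ) / l) = log (n / k) + log (k / l) := by
          rw [← log_mul (by positivity) (by positivity)]
          congr 1
          field_simp
        have e2 := mul_log_le_log_choose (hl.trans hlk) hk
        have e3 : log ((k : ℝ) / l) ≤ k / l - 1 := log_le_sub_one_of_pos (by positivity)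
        have e4 : (l : ℝ) * log (k / l) ≤ k := by
          calc (l : ℝ) * log (k / l) ≤ l * (k / l - 1) := by gcongr
            _ = k - l := by field_simp
            _ ≤ k := by linarith
        have e5 : (l : ℝ) / k * (k * log (n / k)) ≤ l / k * log (n.choose k) := by gcongr
        have e6 : (l : ℝ) / k * (k * log (n / k)) = l * log (n / k) := by field_simp
        rw [e1]
        nlinarith

/-! ### Achievability -/

theorem momentLoss_nonneg {b ρ : ℝ} (h0 : 0 ≤ b) (h1 : b ≤ 1) (hρ : 0 ≤ ρ) :
    0 ≤ momentLoss b ρ := by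
  have e1 := rpow_le_one h0 h1 hρ
  have e2 := rpow_le_one (sub_nonneg.2 h1) (by linarith) hρ
  exact add_nonneg (mul_nonneg (by linarith) (by linarith)) (mul_nonneg h0 (by linarith))

theorem momentLoss_le_one {b ρ : ℝ} (h0 : 0 ≤ b) (h1 : b ≤ 1) : momentLoss b ρ ≤ 1 := by
  have e1 := rpow_nonneg h0 ρ
  have e2 := rpow_nonneg (sub_nonneg.2 h1) ρ
  unfold momentLoss
  nlinarith [mul_nonneg h0 e1, mul_nonneg (sub_nonneg.2 h1) e2]

/-- If `1 - b` is small enough for the fixed exponent `ρ`, the loss is almost as large as the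
probability of the rare outcome. -/
theorem le_momentLoss_of_rpow_le {b ρ η : ℝ} (h0 : 0 ≤ b) (h1 : b ≤ 1) (hρ : 0 ≤ ρ)
    (h : (1 - b) ^ ρ ≤ η) : (1 - η) * (1 - b) ≤ momentLoss b ρ := by
  have e1 := rpow_le_one h0 h1 hρ
  unfold momentLoss
  nlinarith [mul_nonneg h0 (sub_nonneg.2 e1), mul_nonneg (sub_nonneg.2 h1) (sub_nonneg.2 h)]

theorem mul_log_inv_le_one_sub_rpow {x ρ η : ℝ} (h0 : 0 < x) (h1 : x ≤ 1) (hρ : 0 ≤ ρ)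
    (hη : 0 ≤ η) (h : ρ * log x⁻¹ ≤ η) : (1 - η) * (ρ * log x⁻¹) ≤ 1 - x ^ ρ := by
  set y := ρ * log x⁻¹ with hy
  have hy0 : 0 ≤ y := mul_nonneg hρ (log_nonneg ((one_le_inv₀ h0).2 h1))
  have e1 : x ^ ρ = exp (-y) := by
    rw [rpow_def_of_pos h0, hy, log_inv]
    ring_nf
  have e2 := add_one_le_exp y
  have e3 : exp (-y) * exp y = 1 := by rw [← exp_add]; simp
  have e4 := exp_pos (-y)
  rw [e1]
  have e5 : exp (-y) * (1 + y) ≤ 1 := by nlinarith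
  have e6 : exp (-y) ≤ 1 / (1 + y) := by rw [le_div_iff₀ (by linarith)]; exact e5
  have e7 : 1 / (1 + y) ≤ 1 - (1 - η) * y := by
    rw [div_le_iff₀ (by linarith)]
    nlinarith [mul_nonneg hy0 hy0, mul_nonneg (sub_nonneg.2 h) hy0,
      mul_nonneg hη (mul_nonneg hy0 hy0)]
  linarith

/-- For small `ρ` the loss is almost `ρ` times the entropy. -/
theorem le_momentLoss_of_mul_log_le {b ρ η : ℝ} (h0 : 0 < b) (h1 : b < 1) (hρ : 0 ≤ ρ)
    (hη : 0 ≤ η) (hb : ρ * log b⁻¹ ≤ η) (hb' : ρ * log (1 - b)⁻¹ ≤ η) :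
    (1 - η) * ρ * binEntropy b ≤ momentLoss b ρ := by
  have e1 := mul_log_inv_le_one_sub_rpow h0 h1.le hρ hη hb
  have e2 := mul_log_inv_le_one_sub_rpow (sub_pos.2 h1) (by linarith) hρ hη hb'
  unfold momentLoss binEntropy
  have e3 := mul_le_mul_of_nonneg_left e1 h0.le
  have e4 := mul_le_mul_of_nonneg_left e2 (sub_nonneg.2 h1.le)
  linarith

theorem one_sub_one_sub_exp_pow (ν : ℝ) (k l : ℕ) :
    (1 - (1 - exp (-(ν / k)))) ^ l = exp (-((l : ℝ) / k * ν)) := by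
  rw [sub_sub_cancel, ← exp_nat_mul]
  congr 1
  ring

/-- The terms of the random coding bound at `p = 1 - exp (-ν / k)`, so that a test is negative with
probability `exp (-ν)`. -/
theorem codingTerm_le {n k l T : ℕ} {ν ρ : ℝ} (hl : 1 ≤ l) (hlk : l ≤ k) (hν : 0 ≤ ν)
    (hρ : 0 ≤ ρ) :
    codingTerm n k T (1 - exp (-(ν / k))) ρ l ≤ (k.choose l : ℝ) * (((n - k).choose l : ℝ) ^ ρ *
      exp (-(T * (exp (-(ν - (l : ℝ) / k * ν)) * momentLoss (exp (-((l : ℝ) / k * ν))) ρ)))) := by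
  have hk0 : (0 : ℝ) < k := by exact_mod_cast hl.trans hlk
  have hlk' : (l : ℝ) / k ≤ 1 := (div_le_one hk0).2 (by exact_mod_cast hlk)
  have hα : 0 ≤ (l : ℝ) / k * ν := by positivity
  unfold codingTerm
  rw [one_sub_one_sub_exp_pow, one_sub_one_sub_exp_pow]
  have e1 : ((k - l : ℕ) : ℝ) / k * ν = ν - (l : ℝ) / k * ν := by
    rw [Nat.cast_sub hlk]
    field_simp
  rw [e1]
  set A := exp (-(ν - (l : ℝ) / k * ν))
  set m := momentLoss (exp (-((l : ℝ) / k * ν))) ρ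
  have hb1 : exp (-((l : ℝ) / k * ν)) ≤ 1 := exp_le_one_iff.2 (by linarith)
  have hm0 : 0 ≤ m := momentLoss_nonneg (exp_pos _).le hb1 hρ
  have hm1 : m ≤ 1 := momentLoss_le_one (exp_pos _).le hb1
  have hA0 : 0 ≤ A := (exp_pos _).le
  have hA1 : A ≤ 1 := exp_le_one_iff.2 (by nlinarith)
  have e2 : (1 - A * m) ^ T ≤ exp (-(T * (A * m))) := by
    have e3 : exp (-(T * (A * m))) = exp (-(A * m)) ^ T := by
      rw [← exp_nat_mul]; ring_nf
    rw [e3]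
    refine pow_le_pow_left₀ (by nlinarith) ?_ T
    linarith [add_one_le_exp (-(A * m))]
  gcongr

/-- The exchange of a small fraction of the defective items. The exponent of a single item is the
larger one of the two lower bounds on the number of tests, so that a convex combination of the two
beats the number `k` of choices by a power of `n`. -/
theorem codingTerm_le_of_small {n k l T : ℕ} {ν δ : ℝ} (hδ0 : 0 < δ) (hδ1 : δ ≤ 1) (hl : 1 ≤ l)
    (hlk : l ≤ k) (hkn : k ≤ n) (hν : ν ∈ Set.Icc (log 2) 1)
    (hT1 : (1 + δ) * (k * log k) ≤ T * (ν * exp (-ν)))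
    (hT2 : k * log (n / k) ≤ 3 * (T * (ν * exp (-ν))))
    (hx : (1 - exp (-((l : ℝ) / k * ν))) ^ (δ / 64) ≤ δ / 4) :
    codingTerm n k T (1 - exp (-(ν / k))) (δ / 64) l ≤ exp (-(δ / 64 * log n)) ^ l := by
  have hν0 := pos_of_mem_Icc hν
  have hl0 : (0 : ℝ) < l := by exact_mod_cast hl
  have hk0 : (0 : ℝ) < k := by exact_mod_cast hl.trans hlk
  have hn0 : (0 : ℝ) < n := by exact_mod_cast (hl.trans hlk).trans hkn
  refine (codingTerm_le hl hlk hν0.le (by positivity)).trans ?_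
  set α := (l : ℝ) / k with hα
  have hα0 : 0 < α := by positivity
  have hb1 : exp (-(α * ν)) ≤ 1 := exp_le_one_iff.2 (by nlinarith)
  have hm := le_momentLoss_of_rpow_le (exp_pos _).le hb1 (by positivity) hx
  set m := momentLoss (exp (-(α * ν))) (δ / 64)
  set lk := log (k : ℝ) with hlkdef
  set ln := log (n : ℝ) with hlndef
  have hlk0 : 0 ≤ lk := log_cast_nonneg k
  have hln0 : 0 ≤ ln := log_cast_nonneg n
  have hAx : α * (ν * exp (-ν)) ≤ exp (-(ν - α * ν)) * (1 - exp (-(α * ν))) := by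
    have e1 : exp (-(ν - α * ν)) = exp (-ν) * exp (α * ν) := by rw [← exp_add]; ring_nf
    have e2 : exp (α * ν) * exp (-(α * ν)) = 1 := by rw [← exp_add]; simp
    have e3 := add_one_le_exp (α * ν)
    calc α * (ν * exp (-ν)) = exp (-ν) * (α * ν) := by ring
      _ ≤ exp (-ν) * (exp (α * ν) - 1) := by gcongr; linarith
      _ = exp (-(ν - α * ν)) * (1 - exp (-(α * ν))) := by
          rw [e1]; linear_combination (exp (-ν)) * e2
  have hAm : (1 - δ / 4) * (T * (α * (ν * exp (-ν)))) ≤ T * (exp (-(ν - α * ν)) * m) := by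
    have e1 : (1 - δ / 4) * (α * (ν * exp (-ν))) ≤ exp (-(ν - α * ν)) * m := by
      calc (1 - δ / 4) * (α * (ν * exp (-ν)))
          ≤ (1 - δ / 4) * (exp (-(ν - α * ν)) * (1 - exp (-(α * ν)))) :=
            mul_le_mul_of_nonneg_left hAx (by linarith)
        _ = exp (-(ν - α * ν)) * ((1 - δ / 4) * (1 - exp (-(α * ν)))) := by ring
        _ ≤ _ := mul_le_mul_of_nonneg_left hm (exp_pos _).le
    calc _ = T * ((1 - δ / 4) * (α * (ν * exp (-ν)))) := by ring
      _ ≤ _ := mul_le_mul_of_nonneg_left e1 (Nat.cast_nonneg _)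
  -- the two lower bounds on the number of tests, per exchanged item
  set R := T * (α * (ν * exp (-ν))) with hR
  have hRα : R = α * (T * (ν * exp (-ν))) := by rw [hR]; ring
  have hαk : α * k = l := by rw [hα]; field_simp
  have hR1 : l * ((1 + δ) * lk) ≤ R := by
    rw [hRα]
    calc l * ((1 + δ) * lk) = α * ((1 + δ) * (k * lk)) := by rw [← hαk]; ring
      _ ≤ _ := mul_le_mul_of_nonneg_left hT1 hα0.le
  have hR2 : l * (ln - lk) ≤ 3 * R := by
    rw [hRα]
    rw [log_div hn0.ne' hk0.ne'] at hT2
    calc l * (ln - lk) = α * (k * (ln - lk)) := by rw [← hαk]; ring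
      _ ≤ α * (3 * (T * (ν * exp (-ν)))) := mul_le_mul_of_nonneg_left hT2 hα0.le
      _ = _ := by ring
  have hc1 : (k.choose l : ℝ) ≤ exp (l * lk) := by
    calc (k.choose l : ℝ) ≤ (k : ℝ) ^ l := by exact_mod_cast Nat.choose_le_pow k l
      _ = exp (l * lk) := by rw [mul_comm, hlkdef, ← rpow_def_of_pos hk0, rpow_natCast]
  have hc2 : ((n - k).choose l : ℝ) ^ (δ / 64) ≤ exp (δ / 64 * (l * ln)) := by
    have e1 : ((n - k).choose l : ℝ) ≤ exp (l * ln) := by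
      calc ((n - k).choose l : ℝ) ≤ (n.choose l : ℝ) := by
            exact_mod_cast Nat.choose_le_choose l (Nat.sub_le n k)
        _ ≤ (n : ℝ) ^ l := by exact_mod_cast Nat.choose_le_pow n l
        _ = exp (l * ln) := by rw [mul_comm, hlndef, ← rpow_def_of_pos hn0, rpow_natCast]
    calc ((n - k).choose l : ℝ) ^ (δ / 64) ≤ exp (l * ln) ^ (δ / 64) :=
          rpow_le_rpow (Nat.cast_nonneg _) e1 (by positivity)
      _ = _ := by rw [← exp_mul]; ring_nf
  calc _ ≤ exp (l * lk) * (exp (δ / 64 * (l * ln)) * exp (-((1 - δ / 4) * R))) := by gcongr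
    _ = exp (l * lk + δ / 64 * (l * ln) - (1 - δ / 4) * R) := by
        rw [← exp_add, ← exp_add]; ring_nf
    _ ≤ exp (-(l * (δ / 64 * ln))) := by
        rw [exp_le_exp]
        have h1 : (1 - δ / 8) * (l * ((1 + δ) * lk)) + δ / 24 * (l * (ln - lk)) ≤ R := by
          have := mul_le_mul_of_nonneg_left hR1 (by linarith : 0 ≤ 1 - δ / 8)
          have := mul_le_mul_of_nonneg_left hR2 (by linarith : 0 ≤ δ / 24)
          linarith
        have h2 := mul_le_mul_of_nonneg_left h1 (by linarith : 0 ≤ 1 - δ / 4)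
        have h3 : 1 ≤ (1 - δ / 4) * ((1 - δ / 8) * (1 + δ) - δ / 24) := by
          nlinarith [mul_nonneg hδ0.le (sub_nonneg.2 hδ1), pow_pos hδ0 3]
        have h4 : 0 ≤ (l : ℝ) * lk := by positivity
        have h5 := mul_le_mul_of_nonneg_right h3 h4
        have h6 : δ / 32 ≤ (1 - δ / 4) * (δ / 24) := by nlinarith
        have h7 : 0 ≤ (l : ℝ) * ln := by positivity
        have h8 := mul_le_mul_of_nonneg_right h6 h7
        nlinarith
    _ = exp (-(δ / 64 * ln)) ^ l := by rw [← exp_nat_mul]; ring_nf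

/-- The exchange of at least the fraction `x` of the defective items. -/
theorem codingTerm_le_of_large {n k l T : ℕ} {ν δ ρ x : ℝ} (hδ0 : 0 < δ) (hδ1 : δ ≤ 1)
    (hl : 1 ≤ l) (hlk : l ≤ k) (hkn : k ≤ n) (hν : ν ∈ Set.Icc (log 2) 1)
    (hT : (1 + δ) * log (n.choose k) ≤ T * binEntropy (exp (-ν))) (hx0 : 0 < x)
    (hx : x ≤ 1 - exp (-((l : ℝ) / k * ν))) (hρ0 : 0 < ρ) (hρ1 : ρ ≤ δ / 4)
    (hρx : ρ * log x⁻¹ ≤ δ / 4) :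
    codingTerm n k T (1 - exp (-(ν / k))) ρ l
      ≤ exp (3 * k - ρ * x * δ / 2 * log (n.choose k)) := by
  have hν0 := pos_of_mem_Icc hν
  have hl0 : (0 : ℝ) < l := by exact_mod_cast hl
  have hk0 : (0 : ℝ) < k := by exact_mod_cast hl.trans hlk
  refine (codingTerm_le hl hlk hν0.le hρ0.le).trans ?_
  have hc2 : ((n - k).choose l : ℝ) ^ ρ ≤ exp (((l : ℝ) / k * log (n.choose k) + 2 * k) * ρ) := by
    rw [exp_mul]
    exact rpow_le_rpow (Nat.cast_nonneg _) (choose_sub_le_exp hl hlk hkn) hρ0.le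
  set Λ := log (n.choose k : ℝ)
  have hΛ0 : 0 ≤ Λ := log_cast_nonneg _
  set α := (l : ℝ) / k with hα
  have hα0 : 0 < α := by positivity
  have hα1 : α ≤ 1 := (div_le_one hk0).2 (by exact_mod_cast hlk)
  have hαν0 : 0 < α * ν := by positivity
  have hαν1 : α * ν ≤ α := mul_le_of_le_one_right hα0.le hν.2
  have hxα : x ≤ α := by linarith [add_one_le_exp (-(α * ν))]
  obtain ⟨hb0, hb1⟩ := exp_neg_mem_Ioo hαν0
  have hm := le_momentLoss_of_mul_log_le (ρ := ρ) (η := δ / 4) hb0 hb1 hρ0.le (by positivity)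
    (by rw [log_inv, log_exp, neg_neg]; nlinarith)
    (by
      refine le_trans (mul_le_mul_of_nonneg_left ?_ hρ0.le) hρx
      exact log_le_log (inv_pos.2 (by linarith)) (inv_anti₀ hx0 hx))
  have hH := mul_binEntropy_le hν0.le hα0.le hα1
  set H := binEntropy (exp (-ν))
  set Hα := binEntropy (exp (-(α * ν)))
  set m := momentLoss (exp (-(α * ν))) ρ
  set A := exp (-(ν - α * ν))
  have hAm : (1 + δ / 2) * ρ * (α * Λ) ≤ T * (A * m) := by
    have e1 : (1 - δ / 4) * ρ * (α * H) ≤ A * m := by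
      calc (1 - δ / 4) * ρ * (α * H) ≤ (1 - δ / 4) * ρ * (A * Hα) :=
            mul_le_mul_of_nonneg_left hH (mul_nonneg (by linarith) hρ0.le)
        _ = A * ((1 - δ / 4) * ρ * Hα) := by ring
        _ ≤ A * m := mul_le_mul_of_nonneg_left hm (exp_pos _).le
    have e2 : 1 + δ / 2 ≤ (1 - δ / 4) * (1 + δ) := by nlinarith
    calc (1 + δ / 2) * ρ * (α * Λ) = (1 + δ / 2) * (ρ * α * Λ) := by ring
      _ ≤ (1 - δ / 4) * (1 + δ) * (ρ * α * Λ) := by gcongr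
      _ = (1 - δ / 4) * ρ * α * ((1 + δ) * Λ) := by ring
      _ ≤ (1 - δ / 4) * ρ * α * (T * H) :=
          mul_le_mul_of_nonneg_left hT
            (mul_nonneg (mul_nonneg (by linarith) hρ0.le) hα0.le)
      _ = T * ((1 - δ / 4) * ρ * (α * H)) := by ring
      _ ≤ _ := mul_le_mul_of_nonneg_left e1 (Nat.cast_nonneg _)
  have hc1 : (k.choose l : ℝ) ≤ exp k := by
    calc (k.choose l : ℝ) ≤ (2 : ℝ) ^ k := by exact_mod_cast Nat.choose_le_two_pow k l
      _ ≤ exp 1 ^ k := pow_le_pow_left₀ (by norm_num) (by linarith [add_one_le_exp (1 : ℝ)]) k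
      _ = exp k := by rw [← exp_nat_mul, mul_one]
  calc _ ≤ exp k * (exp ((α * Λ + 2 * k) * ρ) * exp (-((1 + δ / 2) * ρ * (α * Λ)))) := by gcongr
    _ = exp (k + (α * Λ + 2 * k) * ρ - (1 + δ / 2) * ρ * (α * Λ)) := by
        rw [← exp_add, ← exp_add]; ring_nf
    _ ≤ _ := by
        rw [exp_le_exp]
        have h1 : ρ * x * δ / 2 * Λ ≤ ρ * α * δ / 2 * Λ := by gcongr
        have h2 : 2 * k * ρ ≤ 2 * k := by nlinarith
        nlinarith

/-- The error probability of the consistent decoder, when the number of tests exceeds both bounds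
by a factor `1 + δ`, tends to zero uniformly in `k`, provided that `n / k` is large. -/
theorem exists_errorProb_consistentDecoder_le {δ : ℝ} (hδ0 : 0 < δ) (hδ1 : δ ≤ 1) :
    ∃ c > 0, ∃ M > 1, ∀ (n k T : ℕ) (ν : ℝ), 1 ≤ k → k < n → M * k ≤ (n : ℝ) →
      ν ∈ Set.Icc (log 2) 1 → (1 + δ) * (k * log k) ≤ T * (ν * exp (-ν)) →
      (1 + δ) * log (n.choose k) ≤ T * binEntropy (exp (-ν)) →
      errorProb k (1 - exp (-(ν / k))) (consistentDecoder n T k)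
        ≤ exp (-(δ / 64 * log n)) / (1 - exp (-(δ / 64 * log n))) + exp (-(c * log n)) := by
  -- `x` separates small and large exchanges, `ρ` is the exponent for the large ones
  set x : ℝ := (δ / 4) ^ (64 / δ) with hx
  have hx0 : 0 < x := rpow_pos_of_pos (by positivity) _
  have hx1 : x ≤ 1 := rpow_le_one (by positivity) (by linarith) (by positivity)
  have hlogx : 0 ≤ log x⁻¹ := log_nonneg ((one_le_inv₀ hx0).2 hx1)
  set ρ : ℝ := δ / 4 / (1 + log x⁻¹) with hρ
  have hρ0 : 0 < ρ := by positivity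
  have hρ1 : ρ ≤ δ / 4 := div_le_self (by positivity) (by linarith)
  have hρx : ρ * log x⁻¹ ≤ δ / 4 := by
    rw [hρ, div_mul_eq_mul_div, div_le_iff₀ (by linarith)]
    nlinarith
  set c : ℝ := ρ * x * δ / 4 with hc
  have hc0 : 0 < c := by positivity
  refine ⟨c, hc0, exp (4 / c), one_lt_exp_iff.2 (by positivity), ?_⟩
  intro n k T ν hk1 hkn' hM hν hT1 hT2
  have hkn : k ≤ n := hkn'.le
  have hν0 := pos_of_mem_Icc hν
  have hk0 : (0 : ℝ) < k := by exact_mod_cast hk1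
  have hn0 : (0 : ℝ) < n := by exact_mod_cast hk1.trans hkn
  set Λ := log (n.choose k : ℝ) with hΛ
  have hΛk : (k : ℝ) * log (n / k) ≤ Λ := mul_log_le_log_choose hk1 hkn
  have hΛn : log n ≤ Λ := log_le_log_choose hk1 hkn'
  have hΛM : 4 * (k : ℝ) ≤ c * Λ := by
    have e1 : 4 / c ≤ log ((n : ℝ) / k) := by
      rw [le_log_iff_exp_le (by positivity), le_div_iff₀ hk0]
      exact hM
    have e2 : (k : ℝ) * (4 / c) ≤ Λ := (mul_le_mul_of_nonneg_left e1 hk0.le).trans hΛk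
    calc 4 * (k : ℝ) = c * (k * (4 / c)) := by field_simp
      _ ≤ _ := mul_le_mul_of_nonneg_left e2 hc0.le
  have hT3 : k * log (n / k) ≤ 3 * (T * (ν * exp (-ν))) := by
    have e1 : binEntropy (exp (-ν)) ≤ 3 * (ν * exp (-ν)) := by
      have e2 : (3 : ℝ)⁻¹ ≤ exp (-ν) := by
        have e3 : (3 : ℝ)⁻¹ ≤ exp (-1) := by
          rw [exp_neg]
          exact inv_anti₀ (exp_pos _) (by linarith [exp_one_lt_d9])
        exact e3.trans (exp_le_exp.2 (by linarith [hν.2]))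
      have e4 : ν * (3 : ℝ)⁻¹ ≤ ν * exp (-ν) := by gcongr
      linarith [binEntropy_le_log_two (p := exp (-ν)), hν.1]
    have e5 : (T : ℝ) * binEntropy (exp (-ν)) ≤ T * (3 * (ν * exp (-ν))) := by gcongr
    have e6 : 0 ≤ Λ := log_cast_nonneg _
    nlinarith
  set y := exp (-(δ / 64 * log n)) with hy
  have hn1 : 0 < log (n : ℝ) := log_pos (by exact_mod_cast (by omega : 1 < n))
  have hy0 : 0 < y := exp_pos _
  have hy1 : y < 1 := exp_lt_one_iff.2 (by have : 0 < δ / 64 * log n := by positivity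
                                           linarith)
  let r : ℕ → ℝ := fun l => if 1 - exp (-((l : ℝ) / k * ν)) ≤ x then δ / 64 else ρ
  have hp : 1 - exp (-(ν / k)) ∈ Set.Icc (0 : ℝ) 1 := by
    have e1 : exp (-(ν / k)) ≤ 1 := exp_le_one_iff.2 (by have : 0 < ν / k := by positivity
                                                         linarith)
    exact ⟨by linarith, by linarith [exp_pos (-(ν / k))]⟩
  refine (errorProb_consistentDecoder_le hkn hp (ρ := r) ?_ ?_).trans ?_
  · intro l
    simp only [r]
    split_ifs <;> positivity
  · intro l
    simp only [r]
    split_ifs <;> linarith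
  have hterm : ∀ l ∈ Finset.Icc 1 k, codingTerm n k T (1 - exp (-(ν / k))) (r l) l
      ≤ y ^ l + exp (3 * k - 2 * c * Λ) := by
    intro l hl
    obtain ⟨hl1, hlk⟩ := Finset.mem_Icc.1 hl
    by_cases h : 1 - exp (-((l : ℝ) / k * ν)) ≤ x
    · have hb1 : exp (-((l : ℝ) / k * ν)) ≤ 1 := by
        have : 0 ≤ (l : ℝ) / k * ν := by positivity
        exact exp_le_one_iff.2 (by linarith)
      have e1 : (1 - exp (-((l : ℝ) / k * ν))) ^ (δ / 64) ≤ δ / 4 := by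
        calc _ ≤ x ^ (δ / 64) := rpow_le_rpow (by linarith) h (by positivity)
          _ = δ / 4 := by
              rw [hx, ← rpow_mul (by positivity)]
              have : 64 / δ * (δ / 64) = 1 := by field_simp
              rw [this, rpow_one]
      have := codingTerm_le_of_small hδ0 hδ1 hl1 hlk hkn hν hT1 hT3 e1
      simp only [r, if_pos h]
      linarith [exp_pos (3 * k - 2 * c * Λ)]
    · have := codingTerm_le_of_large hδ0 hδ1 hl1 hlk hkn hν hT2 hx0 (le_of_not_ge h) hρ0 hρ1 hρx
      have e2 : ρ * x * δ / 2 = 2 * c := by rw [hc]; ring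
      rw [e2] at this
      simp only [r, if_neg h]
      linarith [pow_pos hy0 l]
  refine (Finset.sum_le_sum hterm).trans ?_
  rw [Finset.sum_add_distrib]
  refine add_le_add ?_ ?_
  · have h1 : ∑ l ∈ Finset.Icc 1 k, y ^ l = y * ∑ l ∈ Finset.range k, y ^ l := by
      rw [Finset.mul_sum, Finset.range_eq_Ico, ← Finset.Ico_succ_right_eq_Icc]
      rw [Order.succ_eq_add_one, Finset.sum_Ico_eq_sum_range, Finset.sum_Ico_eq_sum_range]
      simp only [Nat.add_sub_cancel, Nat.sub_zero, Nat.zero_add, pow_add, pow_one]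
    rw [h1, div_eq_mul_inv]
    refine mul_le_mul_of_nonneg_left ?_ hy0.le
    rw [← tsum_geometric_of_lt_one hy0.le hy1]
    exact (summable_geometric_of_lt_one hy0.le hy1).sum_le_tsum _ fun i _ => (pow_pos hy0 i).le
  · rw [Finset.sum_const, nsmul_eq_mul, Nat.card_Icc, Nat.add_sub_cancel]
    calc (k : ℝ) * exp (3 * k - 2 * c * Λ) ≤ exp k * exp (3 * k - 2 * c * Λ) := by
          gcongr
          linarith [add_one_le_exp (k : ℝ)]
      _ = exp (k + (3 * k - 2 * c * Λ)) := by rw [← exp_add]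
      _ ≤ exp (-(c * log n)) := by
          rw [exp_le_exp]
          have := mul_le_mul_of_nonneg_left hΛn hc0.le
          linarith

theorem errorProb_nonneg {n T k : ℕ} {p : ℝ} (hp : p ∈ Set.Icc (0 : ℝ) 1)
    (D : DetectionAlgorithm n T) : 0 ≤ errorProb k p D :=
  mul_nonneg (by positivity) (Finset.sum_nonneg fun _ _ =>
    Finset.sum_nonneg fun X _ => designProb_nonneg hp X)

theorem tendsto_log_cast_atTop : Tendsto (fun n : ℕ => log (n : ℝ)) atTop atTop :=
  tendsto_log_atTop.comp tendsto_natCast_atTop_atTop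

theorem tendsto_exp_neg_mul_log {c : ℝ} (hc : 0 < c) :
    Tendsto (fun n : ℕ => exp (-(c * log n))) atTop (nhds 0) :=
  tendsto_exp_neg_atTop_nhds_zero.comp (tendsto_log_cast_atTop.const_mul_atTop hc)

/-- Achievability: any number of tests above `(1 + δ) * Tstar` suffices. -/
theorem exists_tendsto_errorProb {k : ℕ → ℕ}
    (hk : (fun n : ℕ => (k n : ℝ)) =o[atTop] (fun n : ℕ => (n : ℝ))) {δ : ℝ} (hδ : 0 < δ)
    {T : ℕ → ℕ} (hT : ∀ᶠ n in atTop, (1 + δ) * Tstar n (k n) < (T n : ℝ)) :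
    ∃ (p : ℕ → ℝ) (D : ∀ n, DetectionAlgorithm n (T n)),
      (∀ n, p n ∈ Set.Icc (0 : ℝ) 1) ∧
      Tendsto (fun n => errorProb (k n) (p n) (D n)) atTop (nhds 0) := by
  choose ν hν hTν _ using fun n => exists_Tstar_eq n (k n)
  have hp : ∀ n, 1 - exp (-(ν n / k n)) ∈ Set.Icc (0 : ℝ) 1 := by
    intro n
    have e1 : 0 ≤ ν n / k n := div_nonneg (pos_of_mem_Icc (hν n)).le (Nat.cast_nonneg _)
    have e2 : exp (-(ν n / k n)) ≤ 1 := exp_le_one_iff.2 (by linarith)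
    exact ⟨by linarith, by linarith [exp_pos (-(ν n / k n))]⟩
  refine ⟨fun n => 1 - exp (-(ν n / k n)), fun n => consistentDecoder n (T n) (k n), hp, ?_⟩
  set δ' := min δ 1 with hδ'
  have hδ'0 : 0 < δ' := lt_min hδ one_pos
  obtain ⟨c, hc, M, hM, hbound⟩ := exists_errorProb_consistentDecoder_le hδ'0 (min_le_right δ 1)
  have hlim : Tendsto (fun n : ℕ => exp (-(δ' / 64 * log n)) / (1 - exp (-(δ' / 64 * log n)))
      + exp (-(c * log n))) atTop (nhds 0) := by
    have h1 := tendsto_exp_neg_mul_log (by positivity : 0 < δ' / 64)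
    have h2 := (h1.div (h1.const_sub 1) (by norm_num)).add (tendsto_exp_neg_mul_log hc)
    simpa using h2
  refine tendsto_of_tendsto_of_tendsto_of_le_of_le' tendsto_const_nhds hlim
    (Eventually.of_forall fun n => errorProb_nonneg (hp n) _) ?_
  have hsmall := hk.def (by positivity : 0 < M⁻¹)
  filter_upwards [hT, hsmall, eventually_ge_atTop 2] with n hTn hkn hn2
  rw [norm_natCast, norm_natCast] at hkn
  have hM0 : 0 < M := by linarith
  have hkn' : M * (k n : ℝ) ≤ n := by
    rw [inv_mul_eq_div, le_div_iff₀ hM0] at hkn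
    linarith
  have hn0 : (0 : ℝ) < n := by exact_mod_cast (by omega : 0 < n)
  have hlt : (k n : ℝ) < n := by
    by_contra h
    have h' : (n : ℝ) ≤ k n := le_of_not_gt h
    nlinarith
  have hlt' : k n < n := by exact_mod_cast hlt
  have hT0 : (1 + δ') * Tstar n (k n) ≤ (T n : ℝ) := by
    refine le_trans (mul_le_mul_of_nonneg_right (by linarith [min_le_left δ 1]) ?_) hTn.le
    rw [hTν, testsAt_eq]
    refine le_max_of_le_left (div_nonneg ?_ ?_)
    · exact mul_nonneg (Nat.cast_nonneg _) (log_cast_nonneg _)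
    · exact (mul_pos (pos_of_mem_Icc (hν n)) (exp_pos _)).le
  rcases Nat.eq_zero_or_pos (k n) with h0 | h1
  · have h2 := errorProb_consistentDecoder_le (T := T n) hlt'.le (hp n)
      (ρ := fun _ => 1) (fun _ => one_pos) (fun _ => le_rfl)
    have h3 : Finset.Icc 1 (k n) = ∅ := by rw [h0]; rfl
    rw [h3, Finset.sum_empty] at h2
    refine h2.trans ?_
    have h4 : exp (-(δ' / 64 * log n)) ≤ 1 := exp_le_one_iff.2 (by
      have : 0 ≤ δ' / 64 * log n := mul_nonneg (by positivity) (log_cast_nonneg n)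
      linarith)
    exact add_nonneg (div_nonneg (exp_pos _).le (by linarith)) (exp_pos _).le
  · have hν0 := pos_of_mem_Icc (hν n)
    have hA : 0 < ν n * exp (-ν n) := mul_pos hν0 (exp_pos _)
    have hH := binEntropy_exp_neg_pos hν0
    rw [hTν, testsAt_eq] at hT0
    refine hbound n (k n) (T n) (ν n) h1 hlt' hkn' (hν n) ?_ ?_
    · have := (mul_le_mul_of_nonneg_left (le_max_left _ _) (by linarith : 0 ≤ 1 + δ')).trans hT0
      rwa [← mul_div_assoc, div_le_iff₀ hA] at this
    · have := (mul_le_mul_of_nonneg_left (le_max_right _ _) (by linarith : 0 ≤ 1 + δ')).trans hT0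
      rwa [← mul_div_assoc, div_le_iff₀ hH] at this

/-! ### The entropic converse for many items -/

/-- If the likelier outcome of a test is almost certain, its Rényi sum over all tests is bounded. -/
theorem rpow_add_rpow_pow_le_of_small {a s M : ℝ} {T : ℕ} (h0 : 0 ≤ a) (h1 : a ≤ 1)
    (hs : 1 / 2 ≤ s) (hTM : (T : ℝ) ^ 2 ≤ M) (hM : 0 < M) (ha : a < 1 / M) :
    (a ^ s + (1 - a) ^ s) ^ T ≤ exp 1 := by
  have e1 : a ^ s ≤ √a := by
    rw [sqrt_eq_rpow]
    exact rpow_le_rpow_of_exponent_ge' h0 h1 (by norm_num) hs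
  have e2 : (1 - a) ^ s ≤ 1 := rpow_le_one (by linarith) (by linarith) (by linarith)
  have e3 : (T : ℝ) * √a ≤ 1 := by
    have : ((T : ℝ) * √a) ^ 2 ≤ 1 := by
      rw [mul_pow, sq_sqrt h0]
      calc (T : ℝ) ^ 2 * a ≤ M * (1 / M) := by gcongr
        _ = 1 := by field_simp
    exact (sq_le_one_iff₀ (by positivity)).1 this
  calc (a ^ s + (1 - a) ^ s) ^ T ≤ exp (√a) ^ T := by
        refine pow_le_pow_left₀ (add_nonneg (rpow_nonneg h0 _) (rpow_nonneg (by linarith) _)) ?_ T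
        linarith [add_one_le_exp (√a)]
    _ = exp (T * √a) := by rw [← exp_nat_mul]
    _ ≤ exp 1 := exp_le_exp.2 e3

theorem rpow_one_sub_le {a ε δ : ℝ} (h0 : 0 < a) (h1 : a ≤ 1) (hε : 0 ≤ ε) (hδ : δ ≤ 1)
    (h : ε * log a⁻¹ ≤ δ) : a ^ (1 - ε) ≤ a + ε * (1 + δ) * (a * log a⁻¹) := by
  set y := ε * log a⁻¹ with hy
  have hy0 : 0 ≤ y := mul_nonneg hε (log_nonneg ((one_le_inv₀ h0).2 h1))
  have e1 : a ^ (1 - ε) = a * exp y := by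
    rw [rpow_sub h0, rpow_one, rpow_def_of_pos h0, hy, log_inv, div_eq_mul_inv, ← exp_neg]
    ring_nf
  have e2 := abs_le.1 (abs_exp_sub_one_sub_id_le (x := y) (by rw [abs_of_nonneg hy0]; linarith))
  have e3 : exp y ≤ 1 + (1 + δ) * y := by nlinarith [e2.2, mul_nonneg hy0 (sub_nonneg.2 h)]
  rw [e1]
  calc a * exp y ≤ a * (1 + (1 + δ) * y) := by gcongr
    _ = _ := by rw [hy]; ring

/-- A bound on the Rényi sum by the Shannon entropy. -/
theorem rpow_add_rpow_pow_le {a ε δ M Λ : ℝ} {T : ℕ} (h0 : 0 ≤ a) (h1 : a ≤ 1)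
    (hε0 : 0 ≤ ε) (hε : ε ≤ 1 / 2) (hδ0 : 0 ≤ δ) (hδ : δ ≤ 1) (hM : 1 ≤ M)
    (hεM : ε * log M ≤ δ) (hTM : (T : ℝ) ^ 2 ≤ M) (hΛ : 0 ≤ Λ)
    (hT : T * binEntropy a ≤ (1 - δ) * Λ) :
    (a ^ (1 - ε) + (1 - a) ^ (1 - ε)) ^ T ≤ exp (1 + ε * (1 - δ ^ 2) * Λ) := by
  have hM0 : 0 < M := by linarith
  have hδ2 : 0 ≤ ε * (1 - δ ^ 2) * Λ :=
    mul_nonneg (mul_nonneg hε0 (by nlinarith)) hΛ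
  rcases lt_or_ge a (1 / M) with ha | ha
  · exact (rpow_add_rpow_pow_le_of_small h0 h1 (by linarith) hTM hM0 ha).trans
      (exp_le_exp.2 (by linarith))
  rcases lt_or_ge (1 - a) (1 / M) with hb | hb
  · have := rpow_add_rpow_pow_le_of_small (s := 1 - ε) (T := T) (sub_nonneg.2 h1) (by linarith)
      (by linarith) hTM hM0 hb
    rw [sub_sub_cancel, add_comm] at this
    exact this.trans (exp_le_exp.2 (by linarith))
  have hMinv : 0 < 1 / M := by positivity
  have hlog : ∀ x : ℝ, 1 / M ≤ x → ε * log x⁻¹ ≤ δ := by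
    intro x hx
    refine le_trans (mul_le_mul_of_nonneg_left (log_le_log ?_ ?_) hε0) hεM
    · exact inv_pos.2 (hMinv.trans_le hx)
    · rw [inv_le_comm₀ (hMinv.trans_le hx) hM0, ← one_div]
      exact hx
  have e1 := rpow_one_sub_le (hMinv.trans_le ha) h1 hε0 hδ (hlog a ha)
  have e2 := rpow_one_sub_le (hMinv.trans_le hb) (by linarith) hε0 hδ (hlog (1 - a) hb)
  have e3 : a ^ (1 - ε) + (1 - a) ^ (1 - ε) ≤ exp (ε * (1 + δ) * binEntropy a) := by
    have := add_one_le_exp (ε * (1 + δ) * binEntropy a)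
    unfold binEntropy at this ⊢
    linarith
  calc (a ^ (1 - ε) + (1 - a) ^ (1 - ε)) ^ T ≤ exp (ε * (1 + δ) * binEntropy a) ^ T :=
        pow_le_pow_left₀ (add_nonneg (rpow_nonneg h0 _) (rpow_nonneg (by linarith) _)) e3 T
    _ = exp (ε * (1 + δ) * (T * binEntropy a)) := by rw [← exp_nat_mul]; ring_nf
    _ ≤ exp (1 + ε * (1 - δ ^ 2) * Λ) := by
        rw [exp_le_exp]
        have := mul_le_mul_of_nonneg_left hT (by positivity : 0 ≤ ε * (1 + δ))
        nlinarith

theorem exp_neg_one_le_half : exp (-1) ≤ 1 / 2 := by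
  rw [exp_neg, ← one_div]
  exact one_div_le_one_div_of_le two_pos (by linarith [add_one_le_exp (1 : ℝ)])

/-- The entropic converse: below `(1 - δ) * log (n choose k) / binEntropy a` tests, where `a` is the
probability of a negative test, the error probability is at least `1 / 2`. The order of the Rényi
entropy tends to `1` like the inverse of the logarithm of `log (n choose k)`. -/
theorem eventually_half_le_errorProb_of_entropy {δ : ℝ} (hδ0 : 0 < δ) (hδ1 : δ ≤ 1) :
    ∀ᶠ Λ : ℝ in atTop, ∀ (n k T : ℕ), k ≤ n → log (n.choose k) = Λ → (T : ℝ) ≤ 3 * Λ ^ 2 →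
      ∀ p ∈ Set.Icc (0 : ℝ) 1, T * binEntropy ((1 - p) ^ k) ≤ (1 - δ) * Λ →
      ∀ D : DetectionAlgorithm n T, 1 / 2 ≤ errorProb k p D := by
  have hlog := isLittleO_log_id_atTop.def (by positivity : 0 < δ ^ 3 / 16)
  filter_upwards [hlog, eventually_ge_atTop (4 * log 9 / δ ^ 3), eventually_ge_atTop 1]
    with Λ h1 h2 h3 n k T hk hΛ hT p hp hTH D
  have hΛ0 : 0 < Λ := by linarith
  have hδ3 : 0 < δ ^ 3 := by positivity
  have hlog0 : 0 ≤ log Λ := log_nonneg h3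
  rw [id, norm_of_nonneg hlog0, norm_of_nonneg hΛ0.le] at h1
  rw [div_le_iff₀ hδ3] at h2
  set M := 9 * Λ ^ 4 with hM
  have hM1 : 9 ≤ M := by
    have : 1 ≤ Λ ^ 4 := one_le_pow₀ h3
    linarith
  have hlogM : log M = log 9 + 4 * log Λ := by
    rw [hM, log_mul (by norm_num) (by positivity), log_pow]
    norm_num
  have hlogM2 : 2 ≤ log M := by
    have e1 : log 9 = 2 * log 3 := by
      rw [show (9 : ℝ) = 3 ^ 2 by norm_num, log_pow]
      norm_num
    have e2 : 1 ≤ log 3 := by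
      rw [le_log_iff_exp_le (by norm_num)]
      linarith [exp_one_lt_d9]
    linarith
  set ε := δ / log M with hε
  have hε0 : 0 < ε := by positivity
  have hε1 : ε ≤ 1 / 2 := by
    rw [hε, div_le_iff₀ (by linarith)]
    linarith
  have hεM : ε * log M ≤ δ := by
    rw [hε, div_mul_cancel₀ _ (by linarith)]
  have hTM : (T : ℝ) ^ 2 ≤ M := by
    calc (T : ℝ) ^ 2 ≤ (3 * Λ ^ 2) ^ 2 := by gcongr
      _ = M := by rw [hM]; ring
  have ha0 : 0 ≤ (1 - p) ^ k := pow_nonneg (by linarith [hp.2]) _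
  have ha1 : (1 - p) ^ k ≤ 1 := pow_le_one₀ (by linarith [hp.2]) (by linarith [hp.1])
  have hC : (0 : ℝ) < n.choose k := by exact_mod_cast Nat.choose_pos hk
  have e1 := one_sub_errorProb_le_rpow hk hp D (s := 1 - ε) (by linarith) (by linarith)
  have e2 := rpow_add_rpow_pow_le ha0 ha1 hε0.le hε1 hδ0.le hδ1 (by linarith) hεM hTM hΛ0.le hTH
  have e3 : (n.choose k : ℝ) ^ (1 - ε - 1) = exp (-(ε * Λ)) := by
    rw [rpow_def_of_pos hC, hΛ]
    ring_nf
  rw [e3] at e1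
  have e4 : 1 - errorProb k p D ≤ exp (-1) := by
    refine e1.trans ((mul_le_mul_of_nonneg_left e2 (exp_pos _).le).trans ?_)
    rw [← exp_add, exp_le_exp]
    have e5 : 2 ≤ ε * δ ^ 2 * Λ := by
      have : ε * δ ^ 2 * Λ = δ ^ 3 * Λ / log M := by rw [hε]; ring
      rw [this, le_div_iff₀ (by linarith), hlogM]
      linarith
    linarith
  linarith [exp_neg_one_le_half]

/-! ### The converse from masked defective items -/

theorem mul_pow_le_one {p : ℝ} (hp : p ∈ Set.Icc (0 : ℝ) 1) {k : ℕ} (hk : 1 ≤ k) :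
    (k : ℝ) * (p * (1 - p) ^ (k - 1)) ≤ 1 := by
  have hq : 0 ≤ 1 - p := by linarith [hp.2]
  have h1 := add_pow p (1 - p) k
  rw [add_sub_cancel, one_pow] at h1
  refine le_trans (le_trans (le_of_eq ?_) (Finset.single_le_sum (fun i _ => ?_)
    (Finset.mem_range.2 (by omega : 1 < k + 1)))) h1.ge
  · rw [Nat.choose_one_right]; ring
  · have := hp.1
    positivity

theorem sq_mul_pow_le {p : ℝ} (hp : p ∈ Set.Icc (0 : ℝ) 1) (m : ℕ) :
    p ^ 2 * (1 - p) ^ m ≤ 2 / (m + 1) ^ 2 := by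
  have hq : 0 ≤ 1 - p := by linarith [hp.2]
  have h1 := add_pow p (1 - p) (m + 2)
  rw [add_sub_cancel, one_pow] at h1
  have h2 : p ^ 2 * (1 - p) ^ (m + 2 - 2) * ((m + 2).choose 2 : ℕ) ≤ 1 := by
    refine le_trans ?_ h1.ge
    refine Finset.single_le_sum (f := fun i => p ^ i * (1 - p) ^ (m + 2 - i) *
      ((m + 2).choose i : ℕ)) (fun i _ => ?_) (Finset.mem_range.2 (by omega : 2 < m + 2 + 1))
    have := hp.1
    positivity
  rw [Nat.add_sub_cancel, Nat.cast_choose_two] at h2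
  push_cast at h2
  rw [le_div_iff₀ (by positivity)]
  have h3 : 0 ≤ p ^ 2 * (1 - p) ^ m := by positivity
  have h4 : (0 : ℝ) ≤ m := Nat.cast_nonneg m
  nlinarith [mul_nonneg h3 h4]

theorem exp_neg_le_one_sub {r : ℝ} (h1 : r ≤ 1 / 2) :
    exp (-(r + 2 * r ^ 2)) ≤ 1 - r := by
  have e1 := add_one_le_exp (r + 2 * r ^ 2)
  have e2 : exp (-(r + 2 * r ^ 2)) * exp (r + 2 * r ^ 2) = 1 := by rw [← exp_add]; simp
  have e3 := exp_pos (-(r + 2 * r ^ 2))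
  have e4 : 1 ≤ (1 - r) * (1 + (r + 2 * r ^ 2)) := by nlinarith [sq_nonneg r]
  have e5 : 1 ≤ (1 - r) * exp (r + 2 * r ^ 2) := by nlinarith
  calc exp (-(r + 2 * r ^ 2)) = exp (-(r + 2 * r ^ 2)) * 1 := (mul_one _).symm
    _ ≤ exp (-(r + 2 * r ^ 2)) * ((1 - r) * exp (r + 2 * r ^ 2)) := by gcongr
    _ = 1 - r := by rw [mul_left_comm, e2, mul_one]

/-- The probability that two given nondefective items both avoid all negative tests is almost the
product of the two probabilities. -/
theorem hidden_pair_le {p : ℝ} (hp : p ∈ Set.Icc (0 : ℝ) 1) {k T : ℕ} {η : ℝ}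
    (hpa : p * (1 - p) ^ k ≤ 1 / 2) (hη : T * (4 * (p ^ 2 * (1 - p) ^ k)) ≤ log (1 + η))
    (hη0 : 0 ≤ η) : (1 - (1 - p) ^ k * (1 - (1 - p) ^ 2)) ^ T
      ≤ (1 + η) * ((1 - p * (1 - p) ^ k) ^ T) ^ 2 := by
  have ha0 : 0 ≤ (1 - p) ^ k := pow_nonneg (by linarith [hp.2]) _
  have ha1 : (1 - p) ^ k ≤ 1 := pow_le_one₀ (by linarith [hp.2]) (by linarith [hp.1])
  set a := (1 - p) ^ k
  set z := 4 * (p ^ 2 * a) with hz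
  have hz0 : 0 ≤ z := by positivity
  have hp2 : (1 - p) ^ 2 ≤ 1 := pow_le_one₀ (by linarith [hp.2]) (by linarith [hp.1])
  have e1 : 1 - a * (1 - (1 - p) ^ 2) ≤ (1 - p * a) ^ 2 * exp z := by
    have e2 : 1 / 4 ≤ (1 - p * a) ^ 2 := by nlinarith
    have e3 : (1 - p * a) ^ 2 * (1 + z) ≤ (1 - p * a) ^ 2 * exp z := by
      gcongr
      linarith [add_one_le_exp z]
    nlinarith [mul_le_mul_of_nonneg_right e2 hz0, sq_nonneg (p * a)]
  calc (1 - a * (1 - (1 - p) ^ 2)) ^ T ≤ ((1 - p * a) ^ 2 * exp z) ^ T := by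
        refine pow_le_pow_left₀ ?_ e1 T
        nlinarith [sq_nonneg (1 - p)]
    _ = exp (T * z) * ((1 - p * a) ^ T) ^ 2 := by
        rw [mul_pow, exp_nat_mul, ← pow_mul, ← pow_mul, mul_comm 2 T, mul_comm]
    _ ≤ (1 + η) * ((1 - p * a) ^ T) ^ 2 := by
        gcongr
        rw [← exp_log (by linarith : 0 < 1 + η)]
        exact exp_le_exp.2 hη

/-- The converse from masked defective items: if the expected number `T * p * a` of negative tests
that contain a given item, where `a` is the probability of a negative test, is below
`(1 - δ) * log k`, the error probability is at least `1 / 2`. -/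
theorem eventually_half_le_errorProb_of_masked {δ : ℝ} (hδ0 : 0 < δ) :
    ∀ᶠ k : ℕ in atTop, ∀ (n T : ℕ), 2 * k ≤ n → (T : ℝ) ≤ 3 * (k * log k) →
      ∀ p ∈ Set.Icc (0 : ℝ) 1, T * (p * (1 - p) ^ k) ≤ (1 - δ) * log k →
      ∀ D : DetectionAlgorithm n T, 1 / 2 ≤ errorProb k p D := by
  have hlogk : Tendsto (fun k : ℕ => log (k : ℝ) / k) atTop (nhds 0) :=
    (isLittleO_log_id_atTop.tendsto_div_nhds_zero).comp tendsto_natCast_atTop_atTop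
  have hη := hlogk.eventually (eventually_le_nhds
    (by positivity : 0 < log (1 + 1 / 72 : ℝ) / 24))
  have hE := (tendsto_log_cast_atTop.const_mul_atTop
    (by positivity : 0 < δ / 2)).eventually_ge_atTop (log 144)
  -- the two second-moment bounds below are at most `4 / 144` and `4 / 144 + 4 / 72`, and their sum
  -- `1 / 9` is less than `1 / 2 - 1 / 3`
  filter_upwards [hη, hE, eventually_ge_atTop 2,
    tendsto_natCast_atTop_atTop.eventually_ge_atTop (24 / δ)]
    with k h1 h2 hk2 h3 n T hkn hT p hp hTpa D
  classical
  have hk0 : (0 : ℝ) < k := by exact_mod_cast (by omega : 0 < k)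
  have hq : 0 ≤ 1 - p := by linarith [hp.2]
  set lk := log (k : ℝ) with hlk
  have hlk0 : 0 ≤ lk := log_cast_nonneg k
  set a := (1 - p) ^ k with ha
  set r := p * (1 - p) ^ (k - 1) with hr
  have hr0 : 0 ≤ r := mul_nonneg hp.1 (pow_nonneg hq _)
  have hkr : (k : ℝ) * r ≤ 1 := mul_pow_le_one hp (by omega)
  have hrk : r ≤ 1 / k := by rw [le_div_iff₀ hk0]; linarith
  have hr2 : r ≤ 1 / 2 := by
    refine hrk.trans (one_div_le_one_div_of_le two_pos ?_)
    exact_mod_cast hk2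
  have hpow : (1 - p) ^ k = (1 - p) ^ (k - 1) * (1 - p) := by
    rw [← pow_succ]; congr 1; omega
  have hpar : p * a = r - p ^ 2 * (1 - p) ^ (k - 1) := by rw [ha, hpow, hr]; ring
  have hsq : p ^ 2 * (1 - p) ^ (k - 1) ≤ 2 / (k : ℝ) ^ 2 := by
    have := sq_mul_pow_le hp (k - 1)
    rwa [Nat.cast_sub (by omega : 1 ≤ k), Nat.cast_one, sub_add_cancel] at this
  have hsq0 : 0 ≤ p ^ 2 * (1 - p) ^ (k - 1) := mul_nonneg (sq_nonneg p) (pow_nonneg hq _)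
  have hpar' : p * a ≤ r := by linarith
  have hT3 : ∀ x : ℝ, x ≤ 2 / (k : ℝ) ^ 2 → T * x ≤ 6 * (lk / k) := by
    intro x hx
    calc T * x ≤ T * (2 / (k : ℝ) ^ 2) := by gcongr
      _ ≤ 3 * (k * lk) * (2 / (k : ℝ) ^ 2) := by gcongr
      _ = 6 * (lk / k) := by field_simp; ring
  have hTr : T * (r + 2 * r ^ 2) ≤ (1 - δ / 2) * lk := by
    have e1 : T * r = T * (p * a) + T * (p ^ 2 * (1 - p) ^ (k - 1)) := by rw [hpar]; ring
    have e2 := hT3 _ hsq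
    have e3 : 2 * r ^ 2 ≤ 2 / (k : ℝ) ^ 2 := by
      calc 2 * r ^ 2 ≤ 2 * (1 / k) ^ 2 := by gcongr
        _ = _ := by ring
    have e4 := hT3 _ e3
    have e5 : 12 * (lk / k) ≤ δ / 2 * lk := by
      have : 12 / (k : ℝ) ≤ δ / 2 := by
        rw [div_le_iff₀ hδ0] at h3
        rw [div_le_iff₀ hk0]
        linarith
      calc 12 * (lk / k) = 12 / k * lk := by ring
        _ ≤ _ := by gcongr
    rw [mul_add, e1]
    linarith
  have hμ : 144 ≤ (k : ℝ) * (1 - r) ^ T := by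
    have e1 : exp (-((1 - δ / 2) * lk)) ≤ (1 - r) ^ T := by
      calc exp (-((1 - δ / 2) * lk)) ≤ exp (-(T * (r + 2 * r ^ 2))) :=
            exp_le_exp.2 (by linarith)
        _ = exp (-(r + 2 * r ^ 2)) ^ T := by rw [← exp_nat_mul]; ring_nf
        _ ≤ (1 - r) ^ T := pow_le_pow_left₀ (exp_pos _).le (exp_neg_le_one_sub hr2) T
    calc (144 : ℝ) = exp (log 144) := (exp_log (by norm_num)).symm
      _ ≤ exp (δ / 2 * lk) := exp_le_exp.2 h2
      _ = exp lk * exp (-((1 - δ / 2) * lk)) := by rw [← exp_add]; ring_nf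
      _ = k * exp (-((1 - δ / 2) * lk)) := by rw [hlk, exp_log hk0]
      _ ≤ _ := by gcongr
  have hμ' : 144 ≤ ((n - k : ℕ) : ℝ) * (1 - p * a) ^ T := by
    refine hμ.trans (mul_le_mul ?_ ?_ (pow_nonneg (by linarith) T) (Nat.cast_nonneg _))
    · exact_mod_cast (by omega : k ≤ n - k)
    · exact pow_le_pow_left₀ (by linarith) (by linarith) T
  have hpair : (1 - a * (1 - (1 - p) ^ 2)) ^ T
      ≤ (1 + 1 / 72) * ((1 - p * a) ^ T) ^ 2 := by
    refine hidden_pair_le hp (by linarith) ?_ (by norm_num)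
    have e1 : p ^ 2 * a ≤ 2 / (k : ℝ) ^ 2 := by
      refine le_trans ?_ hsq
      have : a ≤ (1 - p) ^ (k - 1) :=
        pow_le_pow_of_le_one hq (by linarith [hp.1]) (by omega)
      gcongr
    have e2 := hT3 _ e1
    rw [le_div_iff₀ (by norm_num)] at h1
    linarith
  have hB := one_sub_errorProb_le_of_confusable (by omega : k ≤ n) hp D fun K hK =>
    expect_not_confusable_le (T := T) (by omega : 1 ≤ k) hp (by norm_num : (0 : ℝ) ≤ 1 / 72)
      hr2 hpair (by linarith) (by linarith) hK
  have h5 := one_div_le_one_div_of_le (by norm_num : (0 : ℝ) < 144) hμ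
  have h6 := one_div_le_one_div_of_le (by norm_num : (0 : ℝ) < 144) hμ'
  linarith

/-- The converse: below `(1 - δ) * Tstar` tests the error probability is at least `1 / 2`. -/
theorem eventually_half_le_errorProb {k : ℕ → ℕ}
    (hk : (fun n : ℕ => (k n : ℝ)) =o[atTop] (fun n : ℕ => (n : ℝ))) {δ : ℝ} (hδ : 0 < δ) :
    ∀ᶠ n in atTop, ∀ T : ℕ, (T : ℝ) < (1 - δ) * Tstar n (k n) →
      ∀ p ∈ Set.Icc (0 : ℝ) 1, ∀ D : DetectionAlgorithm n T, 1 / 2 ≤ errorProb (k n) p D := by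
  have hTs0 : ∀ n, 0 ≤ Tstar n (k n) := by
    intro n
    obtain ⟨ν, hν, h1, -⟩ := exists_Tstar_eq n (k n)
    rw [h1, testsAt_eq]
    refine le_max_of_le_left (div_nonneg ?_ ?_)
    · exact mul_nonneg (Nat.cast_nonneg _) (log_cast_nonneg _)
    · exact (mul_pos (pos_of_mem_Icc hν) (exp_pos _)).le
  rcases lt_or_ge 1 δ with hδ1 | hδ1
  · refine Eventually.of_forall fun n T hT => ?_
    have h1 : (1 - δ) * Tstar n (k n) ≤ 0 :=
      mul_nonpos_of_nonpos_of_nonneg (by linarith) (hTs0 n)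
    have h2 : (0 : ℝ) ≤ T := Nat.cast_nonneg T
    linarith
  obtain ⟨Λ₀, hΛ₀⟩ := eventually_atTop.1 (eventually_half_le_errorProb_of_entropy hδ hδ1)
  obtain ⟨k₀, hk₀⟩ := eventually_atTop.1 (eventually_half_le_errorProb_of_masked hδ)
  filter_upwards [hk.def (by norm_num : (0 : ℝ) < 1 / 3), eventually_ge_atTop 1,
    tendsto_log_cast_atTop.eventually_ge_atTop Λ₀, tendsto_log_cast_atTop.eventually_ge_atTop 1,
    tendsto_log_cast_atTop.eventually_ge_atTop (2 * (k₀ : ℝ) ^ 2)]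
    with n hkn hn1 hn2 hn3 hn4 T hT p hp D
  rw [norm_natCast, norm_natCast] at hkn
  have hlog2 := log_pos one_lt_two
  have hlog2' : 2 / 3 ≤ log 2 := by linarith [log_two_gt_d9]
  have hn0 : (0 : ℝ) < n := by exact_mod_cast hn1
  set m := k n with hm
  have hlm0 : 0 ≤ log (m : ℝ) := log_cast_nonneg m
  have hTm : Tstar n m ≤ testsAt n m (log 2) :=
    (isLeast_Tstar n m).2 ⟨log 2, hlog2, rfl⟩
  have htests2 : testsAt n m (log 2)
      = max (2 / log 2 * (m * log m)) (log (n.choose m) / log 2) := by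
    rw [testsAt_eq, exp_neg, exp_log two_pos, binEntropy_two_inv]
    congr 1
    field_simp
  rw [htests2] at hTm
  have hm1 : 1 ≤ m := by
    by_contra h
    have h0 : m = 0 := by omega
    rw [h0] at hTm
    simp only [Nat.cast_zero, zero_mul, mul_zero, Nat.choose_zero_right, Nat.cast_one, log_one,
      zero_div, max_self] at hTm
    rw [h0] at hT
    have h2 : (0 : ℝ) ≤ T := Nat.cast_nonneg T
    nlinarith
  have hm0 : (0 : ℝ) < m := by exact_mod_cast hm1
  have hmn : m < n := by
    have : (m : ℝ) < n := by linarith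
    exact_mod_cast this
  set Λ := log (n.choose m : ℝ) with hΛ
  have hΛn : log n ≤ Λ := log_le_log_choose hm1 hmn
  have hmΛ : (m : ℝ) ≤ Λ := by
    have e1 : 1 ≤ log ((n : ℝ) / m) := by
      rw [le_log_iff_exp_le (by positivity), le_div_iff₀ hm0]
      have : exp 1 * m ≤ 3 * m := by gcongr; linarith [exp_one_lt_d9]
      linarith
    have e2 := mul_log_le_log_choose hm1 hmn.le
    nlinarith
  have hlm : log (m : ℝ) ≤ m := by linarith [log_le_sub_one_of_pos hm0]
  have hmm : m * log (m : ℝ) ≤ (m : ℝ) ^ 2 := by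
    rw [sq]; gcongr
  have h2l : 2 / log 2 ≤ 3 := by rw [div_le_iff₀ hlog2]; linarith
  have hmlm : 0 ≤ m * log (m : ℝ) := by positivity
  have hTT : (T : ℝ) ≤ Tstar n m := by nlinarith [hTs0 n]
  have hT3 : (T : ℝ) ≤ 3 * Λ ^ 2 := by
    refine hTT.trans (hTm.trans (max_le ?_ ?_))
    · calc 2 / log 2 * (m * log m) ≤ 3 * (m : ℝ) ^ 2 := by gcongr
        _ ≤ 3 * Λ ^ 2 := by gcongr
    · rw [div_le_iff₀ hlog2]
      nlinarith
  by_cases hent : T * binEntropy ((1 - p) ^ m) ≤ (1 - δ) * Λ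
  · exact hΛ₀ Λ (hn2.trans hΛn) n m T hmn.le rfl hT3 p hp hent D
  rw [not_le] at hent
  have hδ1' : 0 ≤ 1 - δ := by linarith
  -- a test whose outcome is certain has no entropy
  have hp0 : 0 < p := by
    refine lt_of_le_of_ne hp.1 fun h => ?_
    rw [← h, sub_zero, one_pow, binEntropy_one, mul_zero] at hent
    nlinarith
  have hp1 : p < 1 := by
    refine lt_of_le_of_ne hp.2 fun h => ?_
    rw [h, sub_self, zero_pow (by omega), binEntropy_zero, mul_zero] at hent
    nlinarith
  have hT3' : (T : ℝ) ≤ 3 * (m * log m) ∧ Λ ≤ 2 * (m * log m) := by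
    have e1 : (1 - δ) * (Λ / log 2) < T := by
      rw [← mul_div_assoc, div_lt_iff₀ hlog2]
      refine hent.trans_le ?_
      gcongr
      exact binEntropy_le_log_two
    have e2 : Λ / log 2 < Tstar n m := by
      by_contra h
      have := mul_le_mul_of_nonneg_left (not_lt.1 h) hδ1'
      linarith
    rcases le_max_iff.1 hTm with h | h
    · refine ⟨hTT.trans (h.trans (by gcongr)), ?_⟩
      have e3 := e2.trans_le h
      rw [div_lt_iff₀ hlog2] at e3
      have : 2 / log 2 * (m * log m) * log 2 = 2 * (m * log (m : ℝ)) := by field_simp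
      linarith
    · linarith
  have hmk₀ : k₀ ≤ m := by
    by_contra h
    have h1 : (m : ℝ) < k₀ := by exact_mod_cast not_le.1 h
    have h2 : (m : ℝ) ^ 2 < (k₀ : ℝ) ^ 2 := by gcongr
    linarith [hT3'.2]
  have h2mn : 2 * m ≤ n := by
    have : (2 * m : ℝ) ≤ n := by linarith
    exact_mod_cast this
  refine hk₀ m hmk₀ n T h2mn hT3'.1 p hp ?_ D
  have hq : 0 < 1 - p := by linarith
  set ν := -((m : ℝ) * log (1 - p)) with hν
  have hlq : log (1 - p) ≤ -p := by linarith [log_le_sub_one_of_pos hq]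
  have hmpν : m * p ≤ ν := by nlinarith
  have hν0 : 0 < ν := lt_of_lt_of_le (by positivity) hmpν
  have hexp : exp (-ν) = (1 - p) ^ m := by
    rw [hν, neg_neg, mul_comm, ← rpow_def_of_pos hq, rpow_natCast]
  have hTν : Tstar n m ≤ testsAt n m ν := (isLeast_Tstar n m).2 ⟨ν, hν0, rfl⟩
  rw [testsAt_eq, hexp] at hTν
  set a := (1 - p) ^ m with ha
  have ha0 : 0 < a := by positivity
  have hH : 0 < binEntropy a := by rw [← hexp]; exact binEntropy_exp_neg_pos hν0
  have e1 : Λ / binEntropy a < Tstar n m := by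
    by_contra h
    have e2 := mul_le_mul_of_nonneg_left (not_lt.1 h) hδ1'
    have e3 := hT.le.trans e2
    rw [← mul_div_assoc, le_div_iff₀ hH] at e3
    linarith
  have e2 : Tstar n m ≤ m * log m / (ν * a) := by
    rcases le_max_iff.1 hTν with h | h
    · exact h
    · linarith
  have e3 : T * (ν * a) ≤ (1 - δ) * (m * log m) := by
    have e4 := hT.le.trans (mul_le_mul_of_nonneg_left e2 hδ1')
    rwa [← mul_div_assoc, le_div_iff₀ (mul_pos hν0 ha0)] at e4
  have e4 : m * (T * (p * a)) ≤ m * ((1 - δ) * log m) := by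
    calc m * (T * (p * a)) = T * (m * p * a) := by ring
      _ ≤ T * (ν * a) := by gcongr
      _ ≤ (1 - δ) * (m * log m) := e3
      _ = _ := by ring
  exact le_of_mul_le_mul_left e4 hm0

/-! ### The capacity -/

/-- The reciprocal of the rate, in the form of the number of tests per nat of `log (n choose k)`;
`θ / (1 - θ)` is the limit of `k * log k / log (n choose k)`. For `θ = 0` the first bound
disappears. -/
theorem rateAt_eq {θ ν : ℝ} (hθ : θ ∈ Set.Ico (0 : ℝ) 1) (hν : 0 < ν) :
    rateAt θ ν = (log 2 * max (θ / (1 - θ) / (ν * exp (-ν))) (1 / binEntropy (exp (-ν))))⁻¹ := by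
  have h2 : 0 < log 2 := log_pos one_lt_two
  have hA : 0 < ν * exp (-ν) := mul_pos hν (exp_pos _)
  have hH := binEntropy_exp_neg_pos hν
  have h1θ : 0 < 1 - θ := by linarith [hθ.2]
  unfold rateAt
  rw [binaryEntropy_eq]
  split_ifs with h0
  · rw [h0, zero_div, zero_div, max_eq_right (by positivity)]
    field_simp
  · have hθ0 : 0 < θ := lt_of_le_of_ne hθ.1 (Ne.symm h0)
    rw [mul_max_of_nonneg _ _ h2.le]
    have e1 : ν * exp (-ν) / log 2 * ((1 - θ) / θ)
        = (log 2 * (θ / (1 - θ) / (ν * exp (-ν))))⁻¹ := by field_simp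
    have e2 : binEntropy (exp (-ν)) / log 2 = (log 2 * (1 / binEntropy (exp (-ν))))⁻¹ := by
      field_simp
    rw [e1, e2]
    rcases le_total (log 2 * (θ / (1 - θ) / (ν * exp (-ν))))
      (log 2 * (1 / binEntropy (exp (-ν)))) with h | h
    · rw [max_eq_right h, min_eq_right (inv_anti₀ (by positivity) h)]
    · rw [max_eq_left h, min_eq_left (inv_anti₀ (by positivity) h)]

/-- The capacity is attained at some `ν ∈ [log 2, 1]`, where the number of tests per nat is
least. -/
theorem exists_capacityFormula_eq {θ : ℝ} (hθ : θ ∈ Set.Ico (0 : ℝ) 1) :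
    ∃ ν ∈ Set.Icc (log 2) 1, IsGreatest (rateAt θ '' Set.Ioi 0) (capacityFormula θ) ∧
      capacityFormula θ
        = (log 2 * max (θ / (1 - θ) / (ν * exp (-ν))) (1 / binEntropy (exp (-ν))))⁻¹ ∧
      ∀ ν', 0 < ν' → max (θ / (1 - θ) / (ν * exp (-ν))) (1 / binEntropy (exp (-ν)))
        ≤ max (θ / (1 - θ) / (ν' * exp (-ν'))) (1 / binEntropy (exp (-ν'))) := by
  have h2 : 0 < log 2 := log_pos one_lt_two
  obtain ⟨ν, hν, hmin⟩ := exists_forall_max_div_le (x := θ / (1 - θ)) (y := 1)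
    (div_nonneg hθ.1 (by linarith [hθ.2])) zero_le_one
  have hν0 := pos_of_mem_Icc hν
  have hgr : IsGreatest (rateAt θ '' Set.Ioi 0) (rateAt θ ν) := by
    refine ⟨⟨ν, hν0, rfl⟩, ?_⟩
    rintro _ ⟨ν', hν', rfl⟩
    rw [rateAt_eq hθ hν', rateAt_eq hθ hν0]
    refine inv_anti₀ (mul_pos h2 (lt_max_of_lt_right ?_))
      (mul_le_mul_of_nonneg_left (hmin ν' hν') h2.le)
    exact one_div_pos.2 (binEntropy_exp_neg_pos hν0)
  have hcap : capacityFormula θ = rateAt θ ν := hgr.csSup_eq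
  exact ⟨ν, hν, hcap ▸ hgr, hcap.trans (rateAt_eq hθ hν0), hmin⟩

theorem capacityFormula_pos {θ : ℝ} (hθ : θ ∈ Set.Ico (0 : ℝ) 1) : 0 < capacityFormula θ := by
  obtain ⟨ν, hν, -, h, -⟩ := exists_capacityFormula_eq hθ
  rw [h]
  exact inv_pos.2 (mul_pos (log_pos one_lt_two) (lt_max_of_lt_right
    (one_div_pos.2 (binEntropy_exp_neg_pos (pos_of_mem_Icc hν)))))

/-- On `[log 2, 1]`, where `ν * exp (-ν) ≥ 1 / 6`, the larger bound is Lipschitz in the numerator of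
the first one, uniformly in `ν`. -/
theorem max_div_le_add {x x' z ν : ℝ} (hν : ν ∈ Set.Icc (log 2) 1) :
    max (x' / (ν * exp (-ν))) z ≤ max (x / (ν * exp (-ν))) z + 6 * |x' - x| := by
  have hlog2' : 2 / 3 ≤ log 2 := by linarith [log_two_gt_d9]
  have hA : 1 / 6 ≤ ν * exp (-ν) := by
    have e3 : (3 : ℝ)⁻¹ ≤ exp (-ν) := by
      rw [exp_neg]
      exact inv_anti₀ (exp_pos _) ((exp_le_exp.2 hν.2).trans (by linarith [exp_one_lt_d9]))
    nlinarith [hν.1]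
  have hA0 : 0 < ν * exp (-ν) := by linarith
  refine max_le ?_ ?_
  · have e1 : x' / (ν * exp (-ν)) = x / (ν * exp (-ν)) + (x' - x) / (ν * exp (-ν)) := by ring
    have e2 : (x' - x) / (ν * exp (-ν)) ≤ 6 * |x' - x| := by
      rw [div_le_iff₀ hA0]
      nlinarith [le_abs_self (x' - x), abs_nonneg (x' - x)]
    rw [e1]
    linarith [le_max_left (x / (ν * exp (-ν))) z]
  · linarith [le_max_right (x / (ν * exp (-ν))) z, abs_nonneg (x' - x)]

theorem exists_bounds_of_isTheta {θ : ℝ} {k : ℕ → ℕ}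
    (hk : (fun n : ℕ => (k n : ℝ)) =Θ[atTop] (fun n : ℕ => (n : ℝ) ^ θ)) :
    ∃ c₁ > 0, ∃ c₂ > 0, ∀ᶠ n : ℕ in atTop,
      c₁ * (n : ℝ) ^ θ ≤ k n ∧ (k n : ℝ) ≤ c₂ * (n : ℝ) ^ θ := by
  obtain ⟨c₂, hc₂, h2⟩ := hk.1.exists_pos
  obtain ⟨c₁, hc₁, h1⟩ := hk.2.exists_pos
  refine ⟨c₁⁻¹, inv_pos.2 hc₁, c₂, hc₂, ?_⟩
  filter_upwards [h1.bound, h2.bound] with n h1 h2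
  rw [norm_natCast, norm_of_nonneg (rpow_nonneg (Nat.cast_nonneg n) θ)] at h1 h2
  refine ⟨?_, h2⟩
  rw [inv_mul_le_iff₀ hc₁]
  exact h1

theorem isLittleO_of_isTheta {θ : ℝ} (hθ : θ < 1) {k : ℕ → ℕ}
    (hk : (fun n : ℕ => (k n : ℝ)) =Θ[atTop] (fun n : ℕ => (n : ℝ) ^ θ)) :
    (fun n : ℕ => (k n : ℝ)) =o[atTop] (fun n : ℕ => (n : ℝ)) := by
  refine hk.1.trans_isLittleO ?_
  refine isLittleO_of_tendsto' ?_ ?_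
  · filter_upwards [eventually_gt_atTop 0] with n hn h
    exact absurd h (by exact_mod_cast hn.ne')
  · refine ((tendsto_rpow_neg_atTop (sub_pos.2 hθ)).comp tendsto_natCast_atTop_atTop).congr' ?_
    filter_upwards [eventually_gt_atTop 0] with n hn
    have hn0 : (n : ℝ) ≠ 0 := by exact_mod_cast hn.ne'
    rw [Function.comp_apply, neg_sub, rpow_sub_one hn0]

theorem tendsto_log_div_log {θ : ℝ} {k : ℕ → ℕ}
    (hk : (fun n : ℕ => (k n : ℝ)) =Θ[atTop] (fun n : ℕ => (n : ℝ) ^ θ)) :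
    Tendsto (fun n : ℕ => log (k n) / log n) atTop (nhds θ) := by
  obtain ⟨c₁, hc₁, c₂, hc₂, h⟩ := exists_bounds_of_isTheta hk
  have hlim : ∀ c : ℝ, Tendsto (fun n : ℕ => c / log n + θ) atTop (nhds θ) := by
    intro c
    have := (tendsto_log_cast_atTop.const_div_atTop c).add_const θ
    simpa using this
  refine tendsto_of_tendsto_of_tendsto_of_le_of_le' (hlim (log c₁)) (hlim (log c₂)) ?_ ?_ <;>
  · filter_upwards [h, eventually_ge_atTop 2] with n hn hn2
    have hn0 : (0 : ℝ) < n := by exact_mod_cast (by omega : 0 < n)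
    have hl : 0 < log (n : ℝ) := log_pos (by exact_mod_cast (by omega : 1 < n))
    have hnθ : 0 < (n : ℝ) ^ θ := rpow_pos_of_pos hn0 θ
    have hkn : (0 : ℝ) < k n := lt_of_lt_of_le (by positivity) hn.1
    have e1 : ∀ c : ℝ, 0 < c → log c / log n + θ = log (c * (n : ℝ) ^ θ) / log n := by
      intro c hc
      rw [log_mul hc.ne' hnθ.ne', log_rpow hn0]
      field_simp
    rw [e1 _ (by assumption)]
    gcongr
    first | exact hn.1 | exact hn.2

theorem eventually_one_le_and_lt {θ : ℝ} (hθ : θ ∈ Set.Ico (0 : ℝ) 1) {k : ℕ → ℕ}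
    (hk : (fun n : ℕ => (k n : ℝ)) =Θ[atTop] (fun n : ℕ => (n : ℝ) ^ θ)) :
    ∀ᶠ n : ℕ in atTop, 1 ≤ k n ∧ k n < n := by
  obtain ⟨c₁, hc₁, c₂, hc₂, hbd⟩ := exists_bounds_of_isTheta hk
  filter_upwards [hbd, (isLittleO_of_isTheta hθ.2 hk).def (by norm_num : (0 : ℝ) < 1 / 2),
    eventually_gt_atTop 0] with n h1 h2 h3
  have hn0 : (0 : ℝ) < n := by exact_mod_cast h3
  have hkn : (0 : ℝ) < k n :=
    lt_of_lt_of_le (mul_pos hc₁ (rpow_pos_of_pos hn0 θ)) h1.1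
  rw [norm_natCast, norm_natCast] at h2
  exact ⟨by exact_mod_cast hkn, by exact_mod_cast (by linarith : (k n : ℝ) < n)⟩

/-- For `k = Θ(n ^ θ)`, the ratio of the numerators of the two bounds converges. -/
theorem tendsto_mul_log_div_log_choose {θ : ℝ} (hθ : θ ∈ Set.Ico (0 : ℝ) 1) {k : ℕ → ℕ}
    (hk : (fun n : ℕ => (k n : ℝ)) =Θ[atTop] (fun n : ℕ => (n : ℝ) ^ θ)) :
    Tendsto (fun n : ℕ => k n * log (k n) / log (n.choose (k n))) atTop
      (nhds (θ / (1 - θ))) := by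
  have h1θ : 1 - θ ≠ 0 := by linarith [hθ.2]
  have hlog := tendsto_log_div_log hk
  have hinv : Tendsto (fun n : ℕ => 1 / log (n : ℝ)) atTop (nhds 0) :=
    tendsto_log_cast_atTop.const_div_atTop 1
  have hlow : Tendsto (fun n : ℕ => (log (k n) / log n)
      / (1 - log (k n) / log n + 1 / log (n : ℝ))) atTop (nhds (θ / (1 - θ))) := by
    have := hlog.div ((hlog.const_sub 1).add hinv) (by rwa [add_zero])
    rwa [add_zero] at this
  have hup : Tendsto (fun n : ℕ => (log (k n) / log n) / (1 - log (k n) / log n)) atTop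
      (nhds (θ / (1 - θ))) := hlog.div (hlog.const_sub 1) h1θ
  have hcommon : ∀ᶠ n : ℕ in atTop,
      (log (k n) / log n) / (1 - log (k n) / log n + 1 / log (n : ℝ))
        ≤ k n * log (k n) / log (n.choose (k n)) ∧
      k n * log (k n) / log (n.choose (k n))
        ≤ (log (k n) / log n) / (1 - log (k n) / log n) := by
    filter_upwards [eventually_one_le_and_lt hθ hk,
      tendsto_log_cast_atTop.eventually_gt_atTop 0] with n ⟨hk1, hkn⟩ hl
    have hk0 : (0 : ℝ) < k n := by exact_mod_cast hk1
    have hn0 : (0 : ℝ) < n := by exact_mod_cast hk1.trans hkn.le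
    have hlk : 0 ≤ log (k n : ℝ) := log_cast_nonneg _
    have hlt : log (k n : ℝ) < log n := log_lt_log hk0 (by exact_mod_cast hkn)
    have hΛ := mul_log_le_log_choose hk1 hkn.le
    have hΛ' : log (n.choose (k n)) ≤ k n * (log (n / k n) + 1) := by
      rw [log_le_iff_le_exp (by exact_mod_cast Nat.choose_pos hkn.le)]
      exact choose_le_exp (hk1.trans hkn.le) hk1
    rw [log_div hn0.ne' hk0.ne'] at hΛ hΛ'
    have hΛ0 : 0 < log (n.choose (k n) : ℝ) :=
      lt_of_lt_of_le (mul_pos hk0 (by linarith)) hΛ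
    have e1 : (log (k n) / log n) / (1 - log (k n) / log n + 1 / log (n : ℝ))
        = k n * log (k n) / (k n * (log n - log (k n) + 1)) := by
      have : log n - log (k n : ℝ) + 1 ≠ 0 := by linarith
      field_simp
    have e2 : (log (k n) / log n) / (1 - log (k n) / log n)
        = k n * log (k n) / (k n * (log n - log (k n))) := by
      have : log n - log (k n : ℝ) ≠ 0 := by linarith
      field_simp
    rw [e1, e2]
    have hnum : 0 ≤ k n * log (k n : ℝ) := by positivity
    exact ⟨div_le_div_of_nonneg_left hnum hΛ0 hΛ',
      div_le_div_of_nonneg_left hnum (mul_pos hk0 (by linarith)) hΛ⟩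
  exact tendsto_of_tendsto_of_tendsto_of_le_of_le' hlow hup (hcommon.mono fun n h => h.1)
    (hcommon.mono fun n h => h.2)

theorem eventually_log_le_log_choose {θ : ℝ} (hθ : θ ∈ Set.Ico (0 : ℝ) 1) {k : ℕ → ℕ}
    (hk : (fun n : ℕ => (k n : ℝ)) =Θ[atTop] (fun n : ℕ => (n : ℝ) ^ θ)) :
    ∀ᶠ n : ℕ in atTop, log n ≤ log (n.choose (k n)) :=
  (eventually_one_le_and_lt hθ hk).mono fun _ h => log_le_log_choose h.1 h.2

theorem tendsto_logChoose_atTop {θ : ℝ} (hθ : θ ∈ Set.Ico (0 : ℝ) 1) {k : ℕ → ℕ}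
    (hk : (fun n : ℕ => (k n : ℝ)) =Θ[atTop] (fun n : ℕ => (n : ℝ) ^ θ)) :
    Tendsto (fun n => logChoose n (k n)) atTop atTop := by
  unfold logChoose logb
  exact (tendsto_atTop_mono' _ (eventually_log_le_log_choose hθ hk)
    tendsto_log_cast_atTop).atTop_div_const (log_pos one_lt_two)

/-- For `k = Θ(n ^ θ)`, the threshold `Tstar` is asymptotic to
`logChoose n k / capacityFormula θ`. -/
theorem tendsto_Tstar_div_logChoose {θ : ℝ} (hθ : θ ∈ Set.Ico (0 : ℝ) 1) {k : ℕ → ℕ}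
    (hk : (fun n : ℕ => (k n : ℝ)) =Θ[atTop] (fun n : ℕ => (n : ℝ) ^ θ)) :
    Tendsto (fun n => Tstar n (k n) / logChoose n (k n)) atTop
      (nhds (1 / capacityFormula θ)) := by
  have h2 : 0 < log 2 := log_pos one_lt_two
  obtain ⟨ν, hν, -, hcap, hmin⟩ := exists_capacityFormula_eq hθ
  set γ := θ / (1 - θ) with hγ
  set τ := max (γ / (ν * exp (-ν))) (1 / binEntropy (exp (-ν))) with hτ
  have hγn := tendsto_mul_log_div_log_choose hθ hk
  rw [← hγ] at hγn
  set g : ℕ → ℝ := fun n => k n * log (k n) / log (n.choose (k n)) with hg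
  have habs : Tendsto (fun n => log 2 * (6 * |g n - γ|)) atTop (nhds 0) := by
    have := (((hγn.sub_const γ).abs.const_mul 6).const_mul (log 2))
    simpa using this
  rw [hcap, one_div, inv_inv]
  rw [tendsto_iff_norm_sub_tendsto_zero]
  refine squeeze_zero' (Eventually.of_forall fun n => norm_nonneg _) ?_ habs
  filter_upwards [eventually_log_le_log_choose hθ hk,
    tendsto_log_cast_atTop.eventually_gt_atTop 0] with n hn hn0
  have hΛ : 0 < log (n.choose (k n) : ℝ) := hn0.trans_le hn
  -- the number of tests per nat
  have htests : ∀ ν, testsAt n (k n) ν / log (n.choose (k n))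
      = max (g n / (ν * exp (-ν))) (1 / binEntropy (exp (-ν))) := by
    intro ν
    rw [testsAt_eq, ← max_div_div_right hΛ.le]
    congr 1
    · rw [hg]; ring
    · rw [div_div, mul_comm, ← div_div, div_self hΛ.ne']
  obtain ⟨ν', hν', hT, hT'⟩ := exists_Tstar_eq n (k n)
  have hdiv : Tstar n (k n) / logChoose n (k n)
      = log 2 * (Tstar n (k n) / log (n.choose (k n))) := by
    unfold logChoose logb
    field_simp
  have hup : Tstar n (k n) / log (n.choose (k n)) ≤ τ + 6 * |g n - γ| := by
    calc Tstar n (k n) / log (n.choose (k n)) ≤ testsAt n (k n) ν / log (n.choose (k n)) := by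
          rw [hT]
          exact div_le_div_of_nonneg_right (hT' ν (pos_of_mem_Icc hν)) hΛ.le
      _ ≤ _ := by
          rw [htests]
          exact max_div_le_add hν
  have hlo : τ ≤ Tstar n (k n) / log (n.choose (k n)) + 6 * |g n - γ| := by
    rw [hT, htests, abs_sub_comm]
    exact (hmin ν' (pos_of_mem_Icc hν')).trans (max_div_le_add hν')
  rw [hdiv, ← mul_sub, norm_mul, norm_of_nonneg h2.le, norm_eq_abs]
  refine mul_le_mul_of_nonneg_left (abs_le.2 ⟨by linarith, by linarith⟩) h2.le

theorem achievable_of_lt_capacityFormula {θ : ℝ} (hθ : θ ∈ Set.Ico (0 : ℝ) 1) {k : ℕ → ℕ}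
    (hk : (fun n : ℕ => (k n : ℝ)) =Θ[atTop] (fun n : ℕ => (n : ℝ) ^ θ)) {R : ℝ} (hR0 : 0 < R)
    (hR : R < capacityFormula θ) : Achievable k R := by
  set C := capacityFormula θ with hC
  have hC0 : 0 < C := hR0.trans hR
  set δ := (C / R - 1) / 2 with hδ
  have hCR : 1 < C / R := (one_lt_div hR0).2 hR
  have hδ0 : 0 < δ := by linarith
  have hL := tendsto_logChoose_atTop hθ hk
  have hev : ∀ᶠ n in atTop, (1 + δ) * Tstar n (k n) < (⌊logChoose n (k n) / R⌋₊ : ℝ) := by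
    have h1 : Tendsto (fun n => (1 + δ) * (Tstar n (k n) / logChoose n (k n))
        + 1 / logChoose n (k n)) atTop (nhds ((1 + δ) * (1 / C) + 0)) :=
      ((tendsto_Tstar_div_logChoose hθ hk).const_mul _).add (hL.const_div_atTop 1)
    have h2 : (1 + δ) * (1 / C) + 0 < 1 / R := by
      have h3 : 1 + δ < C / R := by linarith
      calc (1 + δ) * (1 / C) + 0 < C / R * (1 / C) := by
            rw [add_zero]; gcongr
        _ = 1 / R := by field_simp
    filter_upwards [h1.eventually (eventually_lt_nhds h2), hL.eventually_gt_atTop 0] with n hn hn0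
    have h3 := mul_lt_mul_of_pos_right hn hn0
    have h4 : ((1 + δ) * (Tstar n (k n) / logChoose n (k n)) + 1 / logChoose n (k n))
        * logChoose n (k n) = (1 + δ) * Tstar n (k n) + 1 := by field_simp
    rw [h4, one_div_mul_eq_div] at h3
    linarith [Nat.lt_floor_add_one (logChoose n (k n) / R)]
  obtain ⟨p, D, hp, hD⟩ := exists_tendsto_errorProb (isLittleO_of_isTheta hθ.2 hk) hδ0 hev
  refine ⟨hR0, _, p, D, hp, ?_, hD⟩
  filter_upwards [hL.eventually_gt_atTop 0] with n hn
  exact Nat.floor_le (by positivity)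

theorem le_capacityFormula_of_achievable {θ : ℝ} (hθ : θ ∈ Set.Ico (0 : ℝ) 1) {k : ℕ → ℕ}
    (hk : (fun n : ℕ => (k n : ℝ)) =Θ[atTop] (fun n : ℕ => (n : ℝ) ^ θ)) {R : ℝ}
    (hR : Achievable k R) : R ≤ capacityFormula θ := by
  by_contra hlt
  rw [not_le] at hlt
  obtain ⟨hR0, T, p, D, hp, hT, hD⟩ := hR
  have hC0 := capacityFormula_pos hθ
  set C := capacityFormula θ with hC
  set δ := (1 - C / R) / 2 with hδ
  have hCR : C / R < 1 := (div_lt_one hR0).2 hlt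
  have hδ0 : 0 < δ := by linarith
  have hL := tendsto_logChoose_atTop hθ hk
  have h1 := (tendsto_Tstar_div_logChoose hθ hk).const_mul (1 - δ)
  have h2 : 1 / R < (1 - δ) * (1 / C) := by
    have h3 : C / R < 1 - δ := by linarith
    calc 1 / R = C / R * (1 / C) := by field_simp
      _ < _ := by gcongr
  have hev : ∀ᶠ n in atTop, 1 / 2 ≤ errorProb (k n) (p n) (D n) := by
    filter_upwards [h1.eventually (eventually_gt_nhds h2), hL.eventually_gt_atTop 0, hT,
      eventually_half_le_errorProb (isLittleO_of_isTheta hθ.2 hk) hδ0] with n hn hn0 hTn hconv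
    refine hconv (T n) (hTn.trans_lt ?_) (p n) (hp n) (D n)
    have h3 := mul_lt_mul_of_pos_right hn hn0
    have h4 : (1 - δ) * (Tstar n (k n) / logChoose n (k n)) * logChoose n (k n)
        = (1 - δ) * Tstar n (k n) := by field_simp
    rwa [h4, one_div_mul_eq_div] at h3
  have h5 : (1 / 2 : ℝ) ≤ 0 := ge_of_tendsto hD hev
  norm_num at h5

theorem isLUB_achievable {θ : ℝ} (hθ : θ ∈ Set.Ico (0 : ℝ) 1) {k : ℕ → ℕ}
    (hk : (fun n : ℕ => (k n : ℝ)) =Θ[atTop] (fun n : ℕ => (n : ℝ) ^ θ)) :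
    IsLUB {R : ℝ | Achievable k R} (capacityFormula θ) := by
  refine ⟨fun R hR => le_capacityFormula_of_achievable hθ hk hR, fun B hB => ?_⟩
  have hC0 := capacityFormula_pos hθ
  refine le_of_forall_lt_imp_le_of_dense fun R hR => ?_
  rcases le_or_gt R 0 with h | h
  · exact h.trans ((half_pos hC0).le.trans
      (hB (achievable_of_lt_capacityFormula hθ hk (half_pos hC0) (half_lt_self hC0))))
  · exact hB (achievable_of_lt_capacityFormula hθ hk h hR)

end GroupTesting

theorem theorem1 :
    -- The threshold number of tests, for `k = o(n)` defectives.
    (∀ k : ℕ → ℕ, (fun n : ℕ => (k n : ℝ)) =o[atTop] (fun n : ℕ => (n : ℝ)) →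
      -- `T*` is a minimum
      (∀ n, IsLeast (GroupTesting.testsAt n (k n) '' Set.Ioi 0) (GroupTesting.Tstar n (k n))) ∧
      -- achievability
      (∀ δ : ℝ, 0 < δ → ∀ T : ℕ → ℕ,
        (∀ᶠ n in atTop, (1 + δ) * GroupTesting.Tstar n (k n) < (T n : ℝ)) →
        ∃ (p : ℕ → ℝ) (D : ∀ n, GroupTesting.DetectionAlgorithm n (T n)),
          (∀ n, p n ∈ Set.Icc (0 : ℝ) 1) ∧
          Tendsto (fun n => GroupTesting.errorProb (k n) (p n) (D n)) atTop (nhds 0)) ∧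
      -- converse
      (∀ δ : ℝ, 0 < δ → ∀ᶠ n in atTop, ∀ T : ℕ,
        (T : ℝ) < (1 - δ) * GroupTesting.Tstar n (k n) →
        ∀ p ∈ Set.Icc (0 : ℝ) 1, ∀ D : GroupTesting.DetectionAlgorithm n T,
          1 / 2 ≤ GroupTesting.errorProb (k n) p D)) ∧
    -- The capacity, for `k = Θ(n ^ θ)` defectives.
    (∀ θ ∈ Set.Ico (0 : ℝ) 1, ∀ k : ℕ → ℕ,
      (fun n : ℕ => (k n : ℝ)) =Θ[atTop] (fun n : ℕ => (n : ℝ) ^ θ) →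
      -- the formula is a maximum
      IsGreatest (GroupTesting.rateAt θ '' Set.Ioi 0) (GroupTesting.capacityFormula θ) ∧
      -- it is the supremum of the achievable rates
      IsLUB {R : ℝ | GroupTesting.Achievable k R} (GroupTesting.capacityFormula θ)) := by
  refine ⟨fun k hk => ⟨fun n => GroupTesting.isLeast_Tstar n (k n),
    fun δ hδ T hT => GroupTesting.exists_tendsto_errorProb hk hδ hT,
    fun δ hδ => GroupTesting.eventually_half_le_errorProb hk hδ⟩,
    fun θ hθ k hk => ⟨?_, GroupTesting.isLUB_achievable hθ hk⟩⟩
  obtain ⟨ν, -, h, -⟩ := GroupTesting.exists_capacityFormula_eq hθ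
  exact h
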